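/- **Definitions.** A *$2$-ball state with hand capacity $m$* is a sequence $\alpha=\langle\alpha_1,\alpha_2,\dots\rangle$ with $\alpha_i\in\{0,\dots,m\}$ and $\sum_i\alpha_i=2$ ($\alpha_i$ is the number of balls landing $i$ beats from now). There is a transition $\alpha\to\beta$ if $\alpha_{i+1}\le\beta_i$ for all $i\ge1$. A *$2$-ball passing state with $k$ hands* is a $k\times\infty$ matrix $A=(a_{i,j})$ with entries in $\{0,1\}$ whose entries sum to $2$; there is a transition $A\to B$ if $a_{i,j+1}\le b_{i,j}$ for all $i,j$. A *prime pattern of length $n$* is a closed walk of length $n$ through $n$ distinct states, considered up to rotation. Let $\mathcal N'(2,n)$ be the set of prime patterns with capacity $1$ (normal patterns), let $\mathcal M'(2,n)$ be the set of prime patterns with capacity $2$ that are not in $\mathcal N'(2,n)$ (strict multiplex patterns), and let $P'(2,n,k)$ be the number of prime passing patterns with $k$ hands. Write $\sigma_{(i,j)}$, $1\le i\le j$, for the capacity-$2$ state with balls landing at beats $i$ and $j$. Every transition $\alpha\to\beta$ of such states is described by exactly one card: $C_0$: $\sigma_{(i+1,j+1)}\to\sigma_{(i,j)}$, $i<j$;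 $C_1$: $\sigma_{(1,j+1)}\to\sigma_{(i,j)}$, $i<j$; $C_2$: $\sigma_{(1,i+1)}\to\sigma_{(i,j)}$, $i<j$; $D_0$: $\sigma_{(i+1,i+1)}\to\sigma_{(i,i)}$; $D_a$: $\sigma_{(1,i+1)}\to\sigma_{(i,i)}$; $D_b$: $\sigma_{(1,1)}\to\sigma_{(i,j)}$, $i<j$; $D_c$: $\sigma_{(1,1)}\to\sigma_{(i,i)}$. For a pattern $\rho$, let $\varphi(\rho)$ be the number of its transitions whose card is $C_1$, $C_2$, $D_a$ or $D_b$. Let $q_1=\tfrac12$ and $q_t=\frac{t-1}{2^t-t-1}\,q_{t-1}$ for $t\ge2$. For nonnegative sequences write $f\gtrsim g$ if for every $\varepsilon>0$ eventually $f\ge(1-\varepsilon)g$. **Theorem.** 1. For all integers $n\ge1$ and $k\ge1$, the sets $\mathcal N'(2,n)$ and $\mathcal M'(2,n)$ and the set of $2$-ball, $k$-hand prime passing patterns of length $n$ are finite, and $$P'(2,n,k)\;\ge\;\sum_{\rho\in\mathcal N'(2,n)}k^{\varphi(\rho)}+\sum_{\rho\in\mathcal M'(2,n)}k^{\varphi(\rho)}(k-1).$$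 2. For every fixed $n\ge2$, $P'(2,n,k)\gtrsim k^{n+1}$ as $k\to\infty$. For every fixed $n\ge1$ (in particular for $n=1$), $k^{n+1}=O\bigl(P'(2,n,k)\bigr)$ as $k\to\infty$. 3. For every fixed $k\ge1$, the series $\gamma_{P'}(k)=\sum_{t=1}^\infty q_tk^t(1+kt-t)$ converges, and $P'(2,n,k)\gtrsim\gamma_{P'}(k)\,2^n$ as $n\to\infty$. -/

import Mathlib

open Filter

namespace Juggling

/-! ### Closed walks up to rotation -/

/-- The multiset of edges `(x₁, x₂), …, (xₙ₋₁, xₙ), (xₙ, x₁)` traversed by a closed walk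
`[x₁, …, xₙ]`; it only depends on the walk up to rotation. -/
def cycleEdges {S : Type*} (c : Cycle S) : Multiset (S × S) :=
  Quotient.liftOn c (fun l => ((l.zip (l.rotate 1) : List (S × S)) : Multiset (S × S))) (by
    rintro l _ ⟨m, rfl⟩
    refine Multiset.coe_eq_coe.2 ?_
    have h : (l.rotate m).zip ((l.rotate m).rotate 1) = (l.zip (l.rotate 1)).rotate m := by
      rw [List.rotate_rotate, Nat.add_comm, ← List.rotate_rotate]
      exact (List.zipWith_rotate_distrib Prod.mk l (l.rotate 1) m (by simp)).symm
    rw [h]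
    exact (List.rotate_perm _ _).symm)

/-- The prime closed walks of length `n` in the directed graph with edge relation `r`: closed
walks `x₁ → x₂ → ⋯ → xₙ → x₁` with `n` distinct vertices, up to rotation. -/
def primeWalks {S : Type*} (r : S → S → Prop) (n : ℕ) : Set (Cycle S) :=
  {c | c.length = n ∧ c.Nodup ∧ c.Chain r}

/-! ### One-handed juggling: normal and multiplex patterns

A state `⟨α₁, α₂, …⟩` is a finitely supported function `α : ℕ →₀ ℕ`, where `α i` is the number of
balls that land `i + 1` beats from now. -/

/-- `b`-ball states for a hand of capacity `m`. -/
def IsState (b m : ℕ) (α : ℕ →₀ ℕ) : Prop :=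
  (∀ i, α i ≤ m) ∧ (α.sum fun _ a => a) = b

/-- Transitions between `b`-ball states of capacity `m`. -/
def Step (b m : ℕ) (α β : ℕ →₀ ℕ) : Prop :=
  IsState b m α ∧ IsState b m β ∧ ∀ i, α (i + 1) ≤ β i

/-- All `b`-ball prime multiplex patterns of length `n` with hand capacity `m`. -/
def multiplexPrime (b n m : ℕ) : Set (Cycle (ℕ →₀ ℕ)) :=
  primeWalks (Step b m) n

/-- The `b`-ball normal prime patterns of length `n` (all entries of the states are `0` or `1`). -/
def normalPrime (b n : ℕ) : Set (Cycle (ℕ →₀ ℕ)) :=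
  primeWalks (Step b 1) n

/-- The 2-ball strict multiplex prime patterns of length `n`: the multiplex prime patterns (of
capacity `2`) that are not normal patterns. -/
def strictMultiplexPrime (n : ℕ) : Set (Cycle (ℕ →₀ ℕ)) :=
  multiplexPrime 2 n 2 \ normalPrime 2 n

/-! ### Cards -/

/-- The 2-ball state with balls landing `i + 1` and `j + 1` beats from now. -/
noncomputable def pairState (i j : ℕ) : ℕ →₀ ℕ :=
  Finsupp.single i 1 + Finsupp.single j 1

/-- The cards of 2-ball (multiplex) juggling. -/
inductive Card
  | C0 | C1 | C2 | D0 | Da | Db | Dc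

/-- `HasCard α β c`: the transition `α → β` of 2-ball states is described by the card `c`. -/
inductive HasCard : (ℕ →₀ ℕ) → (ℕ →₀ ℕ) → Card → Prop
  /-- No ball lands; the balls are at different beats. -/
  | c0 (i j : ℕ) (h : i < j) : HasCard (pairState (i + 1) (j + 1)) (pairState i j) Card.C0
  /-- The landing ball is thrown below the other ball. -/
  | c1 (i j : ℕ) (h : i < j) : HasCard (pairState 0 (j + 1)) (pairState i j) Card.C1
  /-- The landing ball is thrown above the other ball. -/
  | c2 (i j : ℕ) (h : i < j) : HasCard (pairState 0 (i + 1)) (pairState i j) Card.C2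
  /-- No ball lands; the balls are at the same beat. -/
  | d0 (i : ℕ) : HasCard (pairState (i + 1) (i + 1)) (pairState i i) Card.D0
  /-- The landing ball is thrown to the beat of the other ball. -/
  | da (i : ℕ) : HasCard (pairState 0 (i + 1)) (pairState i i) Card.Da
  /-- Both balls land and are thrown to different beats. -/
  | db (i j : ℕ) (h : i < j) : HasCard (pairState 0 0) (pairState i j) Card.Db
  /-- Both balls land and are thrown to the same beat. -/
  | dc (i : ℕ) : HasCard (pairState 0 0) (pairState i i) Card.Dc

/-- The throw cards are `C₁`, `C₂`, `D_a` and `D_b`. -/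
def Card.IsThrow (c : Card) : Prop :=
  c = Card.C1 ∨ c = Card.C2 ∨ c = Card.Da ∨ c = Card.Db

open Classical in
/-- `φ(ρ)`: the number of throw cards in a 2-ball pattern `ρ`. -/
noncomputable def throwCount (ρ : Cycle (ℕ →₀ ℕ)) : ℕ :=
  Multiset.countP (fun e => ∃ c : Card, HasCard e.1 e.2 c ∧ c.IsThrow) (cycleEdges ρ)

/-! ### Passing with `k` hands

A state is a `k × ∞` matrix with entries in `{0, 1}`; `A i j = 1` means that a ball lands in hand
`i` exactly `j + 1` beats from now. -/

/-- `b`-ball passing states for `k` hands. -/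
def IsPassingState (b k : ℕ) (A : Fin k → ℕ →₀ ℕ) : Prop :=
  (∀ i j, A i j ≤ 1) ∧ (∑ i, (A i).sum fun _ a => a) = b

/-- Transitions between `b`-ball passing states. -/
def PassingStep (b k : ℕ) (A B : Fin k → ℕ →₀ ℕ) : Prop :=
  IsPassingState b k A ∧ IsPassingState b k B ∧ ∀ i j, A i (j + 1) ≤ B i j

/-- The `b`-ball, `k`-hand prime passing patterns of length `n`. -/
def passingPrime (b n k : ℕ) : Set (Cycle (Fin k → ℕ →₀ ℕ)) :=
  primeWalks (PassingStep b k) n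

/-- The number `P'(b, n, k)` of `b`-ball, `k`-hand prime passing patterns of length `n`. -/
noncomputable def passingPrimeCount (b n k : ℕ) : ℕ :=
  (passingPrime b n k).ncard

/-! ### Asymptotics -/

/-- `q₁ = 1/2` and `q_t = (t - 1) / (2^t - t - 1) * q_{t-1}` for `t ≥ 2`. (The value at `0` is
never used.) -/
noncomputable def q : ℕ → ℝ
  | 0 => 0
  | 1 => 1 / 2
  | t + 2 => (((t + 2 : ℕ) : ℝ) - 1) / (2 ^ (t + 2) - ((t + 2 : ℕ) : ℝ) - 1) * q (t + 1)

/-- The term `q_t k^t (1 + k t - t)`. -/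
noncomputable def gammaTerm (k t : ℕ) : ℝ :=
  q t * (k : ℝ) ^ t * (1 + (k : ℝ) * t - t)

/-- `f ≳ g`: asymptotically, `f` is at least `(1 - o(1)) g`. -/
def AsympGE (f g : ℕ → ℝ) : Prop :=
  ∀ ε : ℝ, 0 < ε → ∀ᶠ x in atTop, (1 - ε) * g x ≤ f x

end Juggling

namespace Juggling

/-! ### Closed walks as periodic sequences -/

/-! Forgetting hands (`collapse`) turns a passing state into a multiplex state, so patterns can be
counted by fibres over multiplex patterns. To build elements of a fibre, attach to each landing time
u a hand `a u`, and to a second ball landing at the same time a hand `b`. A prime pattern visits the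
state with both balls landing now at most once per period, so a single `b` suffices. There are k
choices of `a u` for each throw card, and, over a strict multiplex pattern, k - 1 choices of `b`
different from the hand of the first ball. Different choices give different passing patterns because
the hands can be read off from the states (`card_le_passingOver`, with `exists_one_of_two` for the
card `D_b`). Summing over the disjoint fibres gives the lower bound.

For fixed n ≥ 2, one strict multiplex pattern all of whose n cards are throws already contributes
k^n (k - 1). For n = 1, constant states with balls in two different hands give k choose 2 patterns.

For fixed k, normal patterns are encoded injectively by words: one letter per landing, recording the
new distance between the balls and whether the throw was `C₁` or `C₂`. The pattern length is the sum
of the `C₂` distances. Raising all distances by one, and possibly inserting a letter of distance 1,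
gives the recursive inequality `wordWeight_rec` on the number of `C₂` letters. For k = 1, dividing
by 2^n makes it a contraction whose fixed points satisfy the recursion of `q`, and the series is
summed over finitely many t. For k ≥ 2, the words with one `C₂` letter already grow like (1 + k)^n,
which dominates 2^n. -/

/-- The closed walk `x 0 → x 1 → ⋯ → x (n - 1) → x 0`. -/
def periodicCycle {S : Type*} (n : ℕ) (x : ℕ → S) : Cycle S :=
  (((List.range n).map x : List S) : Cycle S)

lemma map_range_rotate_one {S : Type*} {n : ℕ} {x : ℕ → S} (hx : Function.Periodic x n) :
    ((List.range n).map x).rotate 1 = (List.range n).map fun t => x (t + 1) := by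
  refine List.ext_getElem (by simp) fun i h₁ h₂ => ?_
  simp [List.getElem_rotate, hx.map_mod_nat]

lemma chain_periodicCycle {S : Type*} {r : S → S → Prop} {n : ℕ} {x : ℕ → S}
    (hx : Function.Periodic x n) :
    (periodicCycle n x).Chain r ↔ ∀ t < n, r (x t) (x (t + 1)) := by
  rcases n with _ | m
  · simp [periodicCycle]
  · have h1 : (List.range (m + 1)).map x = x 0 :: (List.range m).map fun t => x (t + 1) := by
      rw [List.range_succ_eq_map]; simp [Function.comp_def]
    have h2 : x 0 :: (((List.range m).map fun t => x (t + 1)) ++ [x 0])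
        = (List.range (m + 2)).map x := by
      rw [← List.cons_append, ← h1, List.range_succ (n := m + 1), List.map_append]
      have := hx 0
      simp only [zero_add] at this
      simp [this]
    rw [periodicCycle, h1, Cycle.chain_coe_cons, h2, List.isChain_iff_getElem]
    simp

lemma step_of_forall_lt {S : Type*} {r : S → S → Prop} {n : ℕ} (hn : 1 ≤ n) {x : ℕ → S}
    (hx : Function.Periodic x n) (h : ∀ t < n, r (x t) (x (t + 1))) (t : ℕ) :
    r (x t) (x (t + 1)) := by
  have h1 := h (t % n) (Nat.mod_lt _ hn)
  rwa [hx.map_mod_nat, ← hx.map_mod_nat (t % n + 1), Nat.mod_add_mod, hx.map_mod_nat] at h1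

lemma periodicCycle_mem_primeWalks {S : Type*} {r : S → S → Prop} {n : ℕ} {x : ℕ → S}
    (hx : Function.Periodic x n) (hinj : Set.InjOn x (Set.Iio n))
    (h : ∀ t, r (x t) (x (t + 1))) : periodicCycle n x ∈ primeWalks r n := by
  refine ⟨by simp [periodicCycle], ?_, (chain_periodicCycle hx).2 fun t _ => h t⟩
  rw [periodicCycle, Cycle.nodup_coe_iff]
  refine List.Nodup.map_on (fun a ha b hb => hinj ?_ ?_) List.nodup_range
  · simpa using ha
  · simpa using hb

lemma exists_periodic_of_mem_primeWalks {S : Type*} {r : S → S → Prop} {n : ℕ} (hn : 1 ≤ n)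
    {c : Cycle S} (hc : c ∈ primeWalks r n) :
    ∃ x : ℕ → S, Function.Periodic x n ∧ Set.InjOn x (Set.Iio n) ∧
      (∀ t, r (x t) (x (t + 1))) ∧ c = periodicCycle n x := by
  obtain ⟨hlen, hnd, hch⟩ := hc
  induction c using Quotient.inductionOn with | _ l
  change l.length = n at hlen
  change (l : Cycle S).Nodup at hnd
  rw [Cycle.nodup_coe_iff] at hnd
  let x : ℕ → S := fun t => l[t % n]'(by rw [hlen]; exact Nat.mod_lt _ hn)
  have hx : Function.Periodic x n := fun t => by simp [x]
  have hl : (List.range n).map x = l := by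
    refine List.ext_getElem (by simp [hlen]) fun i h₁ h₂ => ?_
    have : i < n := hlen ▸ h₂
    simp [x, Nat.mod_eq_of_lt this]
  have hc : (l : Cycle S) = periodicCycle n x := by rw [periodicCycle, hl]
  refine ⟨x, hx, ?_, ?_, hc⟩
  · intro a ha b hb hab
    have ha' : a < n := ha
    have hb' : b < n := hb
    have := (List.Nodup.getElem_inj_iff hnd).1 hab
    rwa [Nat.mod_eq_of_lt ha', Nat.mod_eq_of_lt hb'] at this
  · refine step_of_forall_lt hn hx ?_
    rw [← chain_periodicCycle hx, ← hc]
    exact hch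

lemma cycleEdges_periodicCycle {S : Type*} {n : ℕ} {x : ℕ → S} (hx : Function.Periodic x n) :
    cycleEdges (periodicCycle n x) = (Multiset.range n).map fun t => (x t, x (t + 1)) := by
  change ((((List.range n).map x).zip (((List.range n).map x).rotate 1) : List (S × S)) :
    Multiset (S × S)) = _
  rw [map_range_rotate_one hx, List.zip_map']
  rfl

/-- If two closed walks agree up to rotation, and their projections agree as sequences and visit
distinct points, then the walks agree. -/
lemma eqOn_of_periodicCycle_eq {S T : Type*} (p : S → T) {n : ℕ} {x y : ℕ → S}
    (hinj : Set.InjOn (fun t => p (x t)) (Set.Iio n)) (hp : ∀ t, p (x t) = p (y t))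
    (h : periodicCycle n x = periodicCycle n y) : ∀ t < n, x t = y t := by
  have h1 : (List.range n).map x ~r (List.range n).map y := Quotient.exact h
  obtain ⟨m, hm⟩ := h1
  have h2 : ((List.range n).map fun t => p (x t)).rotate m = (List.range n).map fun t => p (x t) := by
    have := congrArg (List.map p) hm
    rw [List.map_rotate, List.map_map, List.map_map] at this
    rw [show (fun t => p (x t)) = p ∘ x from rfl, this]
    exact List.map_congr_left fun t _ => (hp t).symm
  have hnd : ((List.range n).map fun t => p (x t)).Nodup :=
    List.Nodup.map_on (fun a ha b hb => hinj (by simpa using ha) (by simpa using hb))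
      List.nodup_range
  intro t ht
  -- The projected list has distinct entries and is fixed by the rotation, so the rotation is
  -- trivial.
  have h3 : m % n = 0 := by
    have := hnd.rotate_congr (by intro h0; simp at h0; omega) m 0 (by rw [h2, List.rotate_zero])
    simpa using this
  have h4 : (List.range n).map x = (List.range n).map y := by
    rw [← hm, ← List.rotate_mod]
    simp [h3]
  exact List.map_inj_left.1 h4 t (by simpa using ht)

lemma map_periodicCycle {S T : Type*} (p : S → T) (n : ℕ) (x : ℕ → S) :
    (periodicCycle n x).map p = periodicCycle n fun t => p (x t) := by
  change (((List.map p ((List.range n).map x) : List T)) : Cycle T) = _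
  rw [List.map_map]; rfl

/-- Prime walks of a fixed length on finitely many vertices are finite in number. -/
lemma primeWalks_finite {S : Type*} {r : S → S → Prop} {n : ℕ} {V : Set S} (hV : V.Finite)
    (h : ∀ c ∈ primeWalks r n, ∀ s ∈ c, s ∈ V) : (primeWalks r n).Finite := by
  have := hV.to_subtype
  refine ((List.finite_length_eq V n).image fun l => ((l.map (↑) : List S) : Cycle S)).subset ?_
  intro c hc
  have hmem := h c hc
  obtain ⟨hlen, -⟩ := hc
  induction c using Quotient.inductionOn with | _ l
  exact ⟨l.attachWith (· ∈ V) hmem, (List.length_attachWith).trans hlen,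
    congrArg (fun l : List S => (l : Cycle S)) (List.attachWith_map_subtype_val hmem)⟩

/-- The transition `α → β` is described by a throw card. -/
def IsThrowStep (α β : ℕ →₀ ℕ) : Prop :=
  ∃ c : Card, HasCard α β c ∧ c.IsThrow

open Classical in
lemma throwCount_periodicCycle {n : ℕ} {x : ℕ → ℕ →₀ ℕ} (hx : Function.Periodic x n) :
    throwCount (periodicCycle n x) = ((Finset.range n).filter fun t =>
      IsThrowStep (x t) (x (t + 1))).card := by
  rw [throwCount, cycleEdges_periodicCycle hx, Multiset.countP_map]
  rfl

/-! ### Finiteness -/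

lemma sum_le_ballSum (α : ℕ →₀ ℕ) (s : Finset ℕ) : ∑ i ∈ s, α i ≤ α.sum fun _ a => a :=
  Finset.sum_le_sum_of_ne_zero fun _ _ h => Finsupp.mem_support_iff.2 h

lemma le_shift {x : ℕ → ℕ → ℕ} (h : ∀ t j, x t (j + 1) ≤ x (t + 1) j) (m t j : ℕ) :
    x t (j + m) ≤ x (t + m) j := by
  induction m generalizing t with
  | zero => exact le_rfl
  | succ m ih =>
    have h1 := h t (j + m)
    have h2 := ih (t + 1)
    rw [← add_assoc, show t + (m + 1) = t + 1 + m by ring]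
    omega

/-- States with at most two balls, all landing within `2 n` beats. -/
def boundedStates (n : ℕ) : Set (ℕ →₀ ℕ) :=
  {α | (α.sum fun _ a => a) ≤ 2 ∧ ∀ j, 2 * n ≤ j → α j = 0}

lemma boundedStates_finite (n : ℕ) : (boundedStates n).Finite := by
  refine ((Finset.range (2 * n)).finsupp fun _ => Finset.range 3).finite_toSet.subset ?_
  intro α hα
  rw [Finset.mem_coe, Finset.mem_finsupp_iff]
  refine ⟨fun j hj => ?_, fun j _ => ?_⟩
  · rw [Finset.mem_range]
    by_contra hlt
    exact (Finsupp.mem_support_iff.1 hj) (hα.2 j (not_lt.1 hlt))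
  · have := sum_le_ballSum α {j}
    have h2 := hα.1
    rw [Finset.sum_singleton] at this
    rw [Finset.mem_range]
    omega

/-- By periodicity, a ball at beat j + n forces one at beat j in the same state n beats later. A
ball at beat i + 2n would thus give three balls, at i, i + n and i + 2n. -/
lemma mem_boundedStates {n : ℕ} (hn : 1 ≤ n) {x : ℕ → ℕ →₀ ℕ} (hx : Function.Periodic x n)
    (hs : ∀ t, ((x t).sum fun _ a => a) ≤ 2) (h : ∀ t j, x t (j + 1) ≤ x (t + 1) j) (t : ℕ) :
    x t ∈ boundedStates n := by
  refine ⟨hs t, fun j hj => ?_⟩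
  by_contra hne
  have hshift : ∀ j, x t (j + n) ≤ x t j := fun j => by
    have := le_shift (x := fun t j => x t j) h n t j
    rwa [hx t] at this
  obtain ⟨i, rfl⟩ := Nat.exists_eq_add_of_le' hj
  have h1 := hshift i
  have h2 := hshift (i + n)
  have h3 := sum_le_ballSum (x t) {i, i + n, i + 2 * n}
  rw [show i + n + n = i + 2 * n by ring] at h2
  rw [Finset.sum_insert (by simp; omega), Finset.sum_insert (by simp; omega),
    Finset.sum_singleton] at h3
  have := hs t
  omega

lemma multiplexPrime_finite {n m : ℕ} (hn : 1 ≤ n) : (multiplexPrime 2 n m).Finite := by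
  refine primeWalks_finite (boundedStates_finite n) fun c hc s hs => ?_
  obtain ⟨x, hx, -, hstep, rfl⟩ := exists_periodic_of_mem_primeWalks hn hc
  obtain ⟨t, -, rfl⟩ := List.mem_map.1 (Cycle.mem_coe_iff.1 hs)
  exact mem_boundedStates hn hx (fun t => (hstep t).1.2.le) (fun t => (hstep t).2.2) t

lemma passingPrime_finite {n k : ℕ} (hn : 1 ≤ n) : (passingPrime 2 n k).Finite := by
  refine primeWalks_finite (Set.Finite.pi' fun _ : Fin k => boundedStates_finite n)
    fun c hc s hs i => ?_
  obtain ⟨x, hx, -, hstep, rfl⟩ := exists_periodic_of_mem_primeWalks hn hc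
  obtain ⟨t, -, rfl⟩ := List.mem_map.1 (Cycle.mem_coe_iff.1 hs)
  refine mem_boundedStates (x := fun t => x t i) hn (fun t => by simp only [hx t]) (fun t => ?_)
    (fun t => (hstep t).2.2 i) t
  rw [← (hstep t).1.2]
  exact Finset.single_le_sum (f := fun i => (x t i).sum fun _ a => a) (fun _ _ => Nat.zero_le _)
    (Finset.mem_univ i)

/-! ### Lifting multiplex patterns to passing patterns -/

/-- The multiplex state underlying a passing state. -/
noncomputable def collapse {k : ℕ} (A : Fin k → ℕ →₀ ℕ) : ℕ →₀ ℕ := ∑ i, A i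

/-- The passing state at time `t` lying over the multiplex state `α t`, where a ball that lands at
time `u` does so in hand `a u`, and a second ball landing simultaneously does so in hand `b`. -/
noncomputable def liftState {k : ℕ} (α : ℕ → ℕ →₀ ℕ) (a : ℕ → Fin k) (b : Fin k) (t : ℕ)
    (i : Fin k) : ℕ →₀ ℕ :=
  Finsupp.onFinset (α t).support
    (fun j => (if 1 ≤ α t j ∧ i = a (t + j) then 1 else 0) + if 2 ≤ α t j ∧ i = b then 1 else 0)
    fun j h => by
      rw [Finsupp.mem_support_iff]
      intro h0
      simp [h0] at h

lemma liftState_apply {k : ℕ} (α : ℕ → ℕ →₀ ℕ) (a : ℕ → Fin k) (b : Fin k) (t : ℕ)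
    (i : Fin k) (j : ℕ) : liftState α a b t i j =
      (if 1 ≤ α t j ∧ i = a (t + j) then 1 else 0) + if 2 ≤ α t j ∧ i = b then 1 else 0 := rfl

lemma collapse_liftState {k : ℕ} {α : ℕ → ℕ →₀ ℕ} (a : ℕ → Fin k) (b : Fin k) {t : ℕ}
    (h : ∀ j, α t j ≤ 2) : collapse (liftState α a b t) = α t := by
  ext j
  have hj := h j
  simp only [collapse, Finsupp.finsetSum_apply, liftState_apply, Finset.sum_add_distrib]
  rcases Nat.lt_or_ge (α t j) 1 with h0 | h1
  · simp [show α t j = 0 by omega]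
  · rcases Nat.lt_or_ge (α t j) 2 with h1' | h2
    · simp [show α t j = 1 by omega]
    · simp [show α t j = 2 by omega]

lemma isPassingState_liftState {k : ℕ} {α : ℕ → ℕ →₀ ℕ} {a : ℕ → Fin k} {b : Fin k} {t : ℕ}
    (h : IsState 2 2 (α t)) (hab : ∀ j, α t j = 2 → b ≠ a (t + j)) :
    IsPassingState 2 k (liftState α a b t) := by
  refine ⟨fun i j => ?_, ?_⟩
  · have h2 := h.1 j
    rw [liftState_apply]
    split_ifs with h3 h4 <;> try omega
    exact absurd (h4.2.symm.trans h3.2) (hab j (by omega))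
  · rw [Finsupp.sum_finsetSum_index (h := fun _ a => a) (fun _ => rfl) fun _ _ _ => rfl]
    change ((collapse (liftState α a b t)).sum fun _ a => a) = 2
    rw [collapse_liftState a b h.1, h.2]

/-- The hand depends only on the absolute landing time t + j, which does not change as the ball
approaches. -/
lemma liftState_mono {k : ℕ} {α : ℕ → ℕ →₀ ℕ} (h : ∀ t j, α t (j + 1) ≤ α (t + 1) j)
    (a : ℕ → Fin k) (b : Fin k) (t : ℕ) (i : Fin k) (j : ℕ) :
    liftState α a b t i (j + 1) ≤ liftState α a b (t + 1) i j := by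
  have := h t j
  rw [liftState_apply, liftState_apply, show t + 1 + j = t + (j + 1) by ring]
  refine Nat.add_le_add ?_ ?_ <;> split_ifs <;> omega

lemma eq_single_of_two {α : ℕ →₀ ℕ} (h : (α.sum fun _ a => a) = 2) {j : ℕ} (hj : 2 ≤ α j) :
    α = Finsupp.single j 2 := by
  ext i
  by_cases hij : i = j
  · subst hij
    have := sum_le_ballSum α {i}
    rw [Finset.sum_singleton] at this
    simp; omega
  · have := sum_le_ballSum α {i, j}
    rw [Finset.sum_pair hij] at this
    rw [Finsupp.single_apply, if_neg (Ne.symm hij)]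
    omega

/-- Both times carry the same state, with two balls at beat 0, and a prime walk has no repeated
state. -/
lemma two_beats_unique {n : ℕ} {α : ℕ → ℕ →₀ ℕ}
    (hinj : Set.InjOn α (Set.Iio n)) (hs : ∀ t, IsState 2 2 (α t)) {s t : ℕ} (hs' : s < n)
    (ht' : t < n) (hs2 : α s 0 = 2) (ht2 : α t 0 = 2) : s = t :=
  hinj hs' ht' ((eq_single_of_two (hs s).2 hs2.ge).trans (eq_single_of_two (hs t).2 ht2.ge).symm)

/-- If both balls are caught at time `t` and thrown to different beats, then the two balls caught
at time `t` had been thrown one after the other. -/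
lemma exists_one_of_two {n : ℕ} (hn : 1 ≤ n) {α : ℕ → ℕ →₀ ℕ} (hα : Function.Periodic α n)
    (hinj : Set.InjOn α (Set.Iio n)) (hstep : ∀ t, Step 2 2 (α t) (α (t + 1))) {t : ℕ}
    (ht : t < n) (h2 : α t 0 = 2) (h1 : ∀ i, α (t + 1) i ≤ 1) :
    ∃ s j, α s j = 1 ∧ (s + j) % n = t := by
  by_contra! hno
  -- Going back in time from the catch at t, the two balls stay together: they could only have been
  -- thrown at the same beat from the state with both balls landing, which occurs only at times
  -- congruent to t. Reaching t + 1 contradicts `h1`.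
  have key : ∀ j < n, α (t + n - j) j = 2 := by
    intro j
    induction j with
    | zero => intro _; rw [Nat.sub_zero, hα, h2]
    | succ j ih =>
      intro hj
      have ihj := ih (by omega)
      set s := t + n - (j + 1) with hs
      rw [show t + n - j = s + 1 by omega] at ihj
      have hmod : (s + (j + 1)) % n = t := by
        rw [show s + (j + 1) = t + n by omega, Nat.add_mod_right, Nat.mod_eq_of_lt ht]
      have hne1 : α s (j + 1) ≠ 1 := fun h => hno s (j + 1) h hmod
      have hle := (hstep s).1.1 (j + 1)
      rcases Nat.lt_or_ge (α s (j + 1)) 1 with h0 | h0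
      · exfalso
        have hsing := eq_single_of_two (hstep s).2.1.2 ihj.ge
        have hz : ∀ i, α s (i + 1) = 0 := fun i => by
          by_cases hij : i = j
          · subst hij; omega
          · have := (hstep s).2.2 i
            rw [hsing, Finsupp.single_apply, if_neg (Ne.symm hij)] at this
            omega
        have hsum := (hstep s).1.2
        have h00 : α s 0 = 2 := by
          have : α s = Finsupp.single 0 (α s 0) := by
            ext i
            rcases i with _ | i
            · simp
            · simp [hz i]
          rw [this, Finsupp.sum_single_index rfl] at hsum
          exact hsum
        have := two_beats_unique hinj (fun t => (hstep t).1) (Nat.mod_lt s hn) ht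
          (by rw [hα.map_mod_nat]; exact h00) h2
        rcases Nat.lt_or_ge s n with hsn | hsn
        · rw [Nat.mod_eq_of_lt hsn] at this; omega
        · rw [Nat.mod_eq_sub_mod hsn, Nat.mod_eq_of_lt (by omega)] at this; omega
      · omega
  have h3 := key (n - 1) (by omega)
  rw [show t + n - (n - 1) = t + 1 by omega] at h3
  have := h1 (n - 1)
  omega

/-- Where a single ball is present, `b` is invisible and the state displays `a`. -/
lemma liftState_inj_one {k : ℕ} {α : ℕ → ℕ →₀ ℕ} {a a' : ℕ → Fin k} {b b' : Fin k} {s j : ℕ}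
    (h1 : α s j = 1) (h : liftState α a b s = liftState α a' b' s) : a (s + j) = a' (s + j) := by
  have := DFunLike.congr_fun (congrFun h (a (s + j))) j
  rw [liftState_apply, liftState_apply] at this
  by_contra hne
  simp [h1, hne] at this

/-- Where two balls are present the state only shows the unordered pair of hands, so `b` is
recovered once `a` is known. -/
lemma liftState_inj_two {k : ℕ} {α : ℕ → ℕ →₀ ℕ} {a : ℕ → Fin k} {b b' : Fin k} {s j : ℕ}
    (h2 : α s j = 2) (hb : b ≠ a (s + j)) (h : liftState α a b s = liftState α a b' s) :
    b = b' := by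
  have := DFunLike.congr_fun (congrFun h b) j
  rw [liftState_apply, liftState_apply] at this
  by_contra hne
  simp [h2, hne, hb] at this

lemma IsThrowStep.cases {α β : ℕ →₀ ℕ} (h : IsThrowStep α β) :
    α 0 = 1 ∨ (α 0 = 2 ∧ ∀ i, β i ≤ 1) := by
  obtain ⟨c, hc, ht⟩ := h
  cases hc with
  | c0 | d0 | dc => simp [Card.IsThrow] at ht
  | c1 | c2 | da => left; simp [pairState]
  | db i j hij =>
    right
    refine ⟨by simp [pairState], fun l => ?_⟩
    simp only [pairState, Finsupp.add_apply, Finsupp.single_apply]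
    split_ifs <;> omega

/-- The passing patterns over a multiplex pattern. -/
def passingOver (n k : ℕ) (ρ : Cycle (ℕ →₀ ℕ)) : Set (Cycle (Fin k → ℕ →₀ ℕ)) :=
  {c ∈ passingPrime 2 n k | c.map collapse = ρ}

open Classical in
/-- Hand assignments at times in `[0, n)` that are `z` when there is no throw card. -/
noncomputable def handChoices {k : ℕ} (n : ℕ) (α : ℕ → ℕ →₀ ℕ) (z : Fin k) :
    Finset (Fin n → Fin k) :=
  Fintype.piFinset fun t => if IsThrowStep (α t) (α (t + 1)) then Finset.univ else {z}

lemma card_handChoices {n k : ℕ} {α : ℕ → ℕ →₀ ℕ} (hα : Function.Periodic α n) (z : Fin k) :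
    (handChoices n α z).card = k ^ throwCount (periodicCycle n α) := by
  classical
  rw [handChoices, Fintype.card_piFinset, throwCount_periodicCycle hα,
    Fin.prod_univ_eq_prod_range (fun t => (if IsThrowStep (α t) (α (t + 1)) then
      (Finset.univ : Finset (Fin k)) else {z}).card) n]
  simp only [apply_ite Finset.card, Finset.card_univ, Fintype.card_fin, Finset.card_singleton]
  rw [Finset.prod_ite, Finset.prod_const, Finset.prod_const_one, mul_one]

/-- Sufficiently distinct hand assignments give distinct passing patterns over a given pattern. -/
lemma card_le_passingOver {n k : ℕ} (hn : 1 ≤ n) {α : ℕ → ℕ →₀ ℕ} (hα : Function.Periodic α n)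
    (hinj : Set.InjOn α (Set.Iio n)) (hstep : ∀ t, Step 2 2 (α t) (α (t + 1)))
    (P : Finset (Σ _ : Fin n → Fin k, Fin k)) (z : Fin k)
    (hP1 : ∀ p ∈ P, p.1 ∈ handChoices n α z)
    (hP2 : ∀ p ∈ P, ∀ t : Fin n, α t 0 = 2 → p.2 ≠ p.1 t)
    (hP3 : (∃ t < n, α t 0 = 2) ∨ ∀ p ∈ P, p.2 = z) :
    P.card ≤ (passingOver n k (periodicCycle n α)).ncard := by
  classical
  have hmod : ∀ t : ℕ, t % n < n := fun t => Nat.mod_lt t hn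
  let ext : (Fin n → Fin k) → ℕ → Fin k := fun a t => a ⟨t % n, hmod t⟩
  let L : (Σ _ : Fin n → Fin k, Fin k) → ℕ → Fin k → ℕ →₀ ℕ :=
    fun p => liftState α (ext p.1) p.2
  have hLper : ∀ p, Function.Periodic (L p) n := fun p t => by
    funext i
    refine Finsupp.ext fun j => ?_
    simp only [L, liftState_apply, hα t, ext]
    rw [show t + n + j = t + j + n by ring]
    simp only [Nat.add_mod_right]
  have hcol : ∀ p t, collapse (L p t) = α t := fun p t =>
    collapse_liftState _ _ (hstep t).1.1
  have hfin : (passingOver n k (periodicCycle n α)).Finite :=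
    (passingPrime_finite hn).subset fun c hc => hc.1
  have hab : ∀ p ∈ P, ∀ t j, α t j = 2 → p.2 ≠ ext p.1 (t + j) := by
    intro p hp t j htj
    refine hP2 p hp ⟨(t + j) % n, hmod _⟩ ?_
    have h1 := le_shift (x := fun t j => α t j) (fun t => (hstep t).2.2) j t 0
    have h2 := (hstep (t + j)).1.1 0
    simp only [zero_add] at h1
    rw [htj] at h1
    change α ((t + j) % n) 0 = 2
    rw [hα.map_mod_nat]
    omega
  rw [← Set.ncard_coe_finset]
  refine Set.ncard_le_ncard_of_injOn (fun p => periodicCycle n (L p)) ?_ ?_ hfin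
  · intro p hp
    refine ⟨periodicCycle_mem_primeWalks (hLper p) ?_ fun t => ⟨?_, ?_, ?_⟩, ?_⟩
    · intro s hs t ht hst
      exact hinj hs ht (by rw [← hcol p s, ← hcol p t, hst])
    · exact isPassingState_liftState (hstep t).1 (hab p hp t)
    · exact isPassingState_liftState (hstep t).2.1 (hab p hp (t + 1))
    · exact liftState_mono (fun t => (hstep t).2.2) _ _ t
    · rw [map_periodicCycle]
      simp only [hcol]
  · intro p hp p' hp' heq
    have hlt := eqOn_of_periodicCycle_eq collapse (x := L p) (y := L p')
      (by simpa only [hcol] using hinj) (fun t => by rw [hcol, hcol]) heq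
    have hall : ∀ t, L p t = L p' t := fun t => by
      rw [← (hLper p).map_mod_nat, ← (hLper p').map_mod_nat]
      exact hlt _ (hmod t)
    -- At a throw card some state shows exactly one ball landing at that time, which reveals the
    -- hand; elsewhere the hand is `z` by convention.
    have h1 : p.1 = p'.1 := by
      funext t
      by_cases hthrow : IsThrowStep (α t) (α (t + 1))
      · have : ∃ s j, α s j = 1 ∧ (s + j) % n = t := by
          rcases hthrow.cases with h1 | ⟨h2, hle⟩
          · exact ⟨t, 0, h1, Nat.mod_eq_of_lt t.2⟩
          · exact exists_one_of_two hn hα hinj hstep t.2 h2 hle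
        obtain ⟨s, j, hsj, hmodt⟩ := this
        have := liftState_inj_one hsj (hall s)
        have ht : (⟨(s + j) % n, hmod _⟩ : Fin n) = t := Fin.ext hmodt
        simpa only [ext, ht] using this
      · have ha := Fintype.mem_piFinset.1 (hP1 p hp) t
        have ha' := Fintype.mem_piFinset.1 (hP1 p' hp') t
        rw [if_neg hthrow, Finset.mem_singleton] at ha ha'
        rw [ha, ha']
    have h2 : p.2 = p'.2 := by
      rcases hP3 with ⟨t, -, ht2⟩ | hz
      · have := hall t
        simp only [L, ← h1] at this
        exact liftState_inj_two ht2 (hab p hp t 0 ht2) this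
      · rw [hz p hp, hz p' hp']
    rcases p with ⟨a, b⟩
    rcases p' with ⟨a', b'⟩
    cases h1
    cases h2
    rfl

/-! ### Fibre sizes and their sum -/

lemma IsState.mono {b m m' : ℕ} (h : m ≤ m') {α : ℕ →₀ ℕ} (hα : IsState b m α) :
    IsState b m' α := ⟨fun i => (hα.1 i).trans h, hα.2⟩

lemma Step.mono {b m m' : ℕ} (h : m ≤ m') {α β : ℕ →₀ ℕ} (hs : Step b m α β) :
    Step b m' α β := ⟨hs.1.mono h, hs.2.1.mono h, hs.2.2⟩

lemma normalPrime_subset {n : ℕ} (hn : 1 ≤ n) : normalPrime 2 n ⊆ multiplexPrime 2 n 2 := by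
  intro ρ hρ
  obtain ⟨x, hx, hinj, hstep, rfl⟩ := exists_periodic_of_mem_primeWalks hn hρ
  exact periodicCycle_mem_primeWalks hx hinj fun t => (hstep t).mono one_le_two

lemma pow_le_passingOver {n k : ℕ} (hn : 1 ≤ n) (hk : 1 ≤ k) {ρ : Cycle (ℕ →₀ ℕ)}
    (hρ : ρ ∈ normalPrime 2 n) : k ^ throwCount ρ ≤ (passingOver n k ρ).ncard := by
  obtain ⟨α, hα, hinj, hstep, rfl⟩ := exists_periodic_of_mem_primeWalks hn hρ
  let z : Fin k := ⟨0, hk⟩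
  have := card_le_passingOver hn hα hinj (fun t => (hstep t).mono one_le_two)
    ((handChoices n α z).sigma fun _ => {z}) z (fun p hp => (Finset.mem_sigma.1 hp).1)
    (fun p _ t ht => ?_) (Or.inr fun p hp => by simpa using (Finset.mem_sigma.1 hp).2)
  · simpa [card_handChoices hα] using this
  · have := (hstep t).1.1 0
    omega

lemma exists_two_of_strict {n : ℕ} (hn : 1 ≤ n) {α : ℕ → ℕ →₀ ℕ} (hα : Function.Periodic α n)
    (hinj : Set.InjOn α (Set.Iio n)) (hstep : ∀ t, Step 2 2 (α t) (α (t + 1)))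
    (h : periodicCycle n α ∉ normalPrime 2 n) : ∃ t < n, α t 0 = 2 := by
  have h1 : ∃ t j, ¬ α t j ≤ 1 := by
    by_contra! hle
    exact h (periodicCycle_mem_primeWalks hα hinj fun t =>
      ⟨⟨hle t, (hstep t).1.2⟩, ⟨hle (t + 1), (hstep t).2.1.2⟩, (hstep t).2.2⟩)
  obtain ⟨t, j, htj⟩ := h1
  have h1 := le_shift (x := fun t j => α t j) (fun t => (hstep t).2.2) j t 0
  have h2 := (hstep (t + j)).1.1 0
  simp only [zero_add] at h1
  refine ⟨(t + j) % n, Nat.mod_lt _ hn, ?_⟩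
  rw [hα.map_mod_nat]
  omega

/-- The pattern has exactly one time t₀ in a period at which two balls land; `b` ranges over the k -
1 hands other than `a t₀`. -/
lemma pow_mul_le_passingOver {n k : ℕ} (hn : 1 ≤ n) (hk : 1 ≤ k) {ρ : Cycle (ℕ →₀ ℕ)}
    (hρ : ρ ∈ strictMultiplexPrime n) :
    k ^ throwCount ρ * (k - 1) ≤ (passingOver n k ρ).ncard := by
  obtain ⟨α, hα, hinj, hstep, rfl⟩ := exists_periodic_of_mem_primeWalks hn hρ.1
  obtain ⟨t₀, ht₀, h2⟩ := exists_two_of_strict hn hα hinj hstep hρ.2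
  let z : Fin k := ⟨0, hk⟩
  have := card_le_passingOver hn hα hinj hstep
    ((handChoices n α z).sigma fun a => Finset.univ.erase (a ⟨t₀, ht₀⟩)) z
    (fun p hp => (Finset.mem_sigma.1 hp).1) (fun p hp t ht => ?_) (Or.inl ⟨t₀, ht₀, h2⟩)
  · simpa [Finset.card_sigma, card_handChoices hα, Finset.card_erase_of_mem] using this
  · have htt : t = ⟨t₀, ht₀⟩ :=
      Fin.ext (two_beats_unique hinj (fun t => (hstep t).1) t.2 ht₀ ht h2)
    rw [htt]
    exact (Finset.mem_erase.1 (Finset.mem_sigma.1 hp).2).1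

/-- Fibres of `collapse` over different patterns are disjoint. -/
lemma sum_passingOver_le {n k : ℕ} (hn : 1 ≤ n) (U : Finset (Cycle (ℕ →₀ ℕ))) :
    ∑ ρ ∈ U, (passingOver n k ρ).ncard ≤ passingPrimeCount 2 n k := by
  classical
  have hfin := passingPrime_finite (k := k) hn
  rw [passingPrimeCount, Set.ncard_eq_toFinset_card _ hfin]
  calc ∑ ρ ∈ U, (passingOver n k ρ).ncard
      = ∑ ρ ∈ U, (hfin.toFinset.filter fun c => c.map collapse = ρ).card := by
        refine Finset.sum_congr rfl fun ρ _ => ?_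
        rw [← Set.ncard_coe_finset]
        congr 1
        ext c
        simp [passingOver]
    _ = (U.biUnion fun ρ => hfin.toFinset.filter fun c => c.map collapse = ρ).card := by
        rw [Finset.card_biUnion]
        intro x _ y _ hxy
        rw [Function.onFun, Finset.disjoint_left]
        intro c hc hc'
        exact hxy ((Finset.mem_filter.1 hc).2.symm.trans (Finset.mem_filter.1 hc').2)
    _ ≤ _ := Finset.card_le_card (Finset.biUnion_subset.2 fun _ _ => Finset.filter_subset _ _)

lemma normalPrime_finite {n : ℕ} (hn : 1 ≤ n) : (normalPrime 2 n).Finite :=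
  (multiplexPrime_finite hn).subset (normalPrime_subset hn)

lemma strictMultiplexPrime_finite {n : ℕ} (hn : 1 ≤ n) : (strictMultiplexPrime n).Finite :=
  (multiplexPrime_finite hn).subset Set.sdiff_subset

lemma sum_pow_throwCount_le {n k : ℕ} (hn : 1 ≤ n) (hk : 1 ≤ k) :
    ∑ ρ ∈ (normalPrime_finite hn).toFinset, k ^ throwCount ρ +
      ∑ ρ ∈ (strictMultiplexPrime_finite hn).toFinset, k ^ throwCount ρ * (k - 1)
    ≤ passingPrimeCount 2 n k := by
  classical
  refine le_trans ?_ (sum_passingOver_le (k := k) hn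
    ((normalPrime_finite hn).toFinset ∪ (strictMultiplexPrime_finite hn).toFinset))
  rw [Finset.sum_union]
  · refine Nat.add_le_add (Finset.sum_le_sum fun ρ hρ => ?_) (Finset.sum_le_sum fun ρ hρ => ?_)
    · exact pow_le_passingOver hn hk ((Set.Finite.mem_toFinset _).1 hρ)
    · exact pow_mul_le_passingOver hn hk ((Set.Finite.mem_toFinset _).1 hρ)
  · rw [Finset.disjoint_left]
    intro ρ h1 h2
    exact ((Set.Finite.mem_toFinset _).1 h2).2 ((Set.Finite.mem_toFinset _).1 h1)

theorem finsum_pow_throwCount_le {n k : ℕ} (hn : 1 ≤ n) (hk : 1 ≤ k) :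
    (∑ᶠ ρ ∈ normalPrime 2 n, (k : ℤ) ^ throwCount ρ) +
        (∑ᶠ ρ ∈ strictMultiplexPrime n, (k : ℤ) ^ throwCount ρ * ((k : ℤ) - 1))
      ≤ (passingPrimeCount 2 n k : ℤ) := by
  rw [finsum_mem_eq_finite_toFinset_sum _ (normalPrime_finite hn),
    finsum_mem_eq_finite_toFinset_sum _ (strictMultiplexPrime_finite hn)]
  have := sum_pow_throwCount_le hn hk
  zify [hk] at this
  exact this

/-! ### Cards and transitions -/

lemma pairState_apply (i j l : ℕ) :
    pairState i j l = (if i = l then 1 else 0) + if j = l then 1 else 0 := by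
  simp only [pairState, Finsupp.add_apply, Finsupp.single_apply]

lemma sum_pairState (i j : ℕ) : ((pairState i j).sum fun _ a => a) = 2 := by
  rw [pairState, Finsupp.sum_add_index' (fun _ => rfl) fun _ _ _ => rfl]
  simp

lemma isState_pairState (i j : ℕ) : IsState 2 2 (pairState i j) :=
  ⟨fun l => by rw [pairState_apply]; split_ifs <;> omega, sum_pairState i j⟩

lemma isState_pairState_of_lt {i j : ℕ} (h : i < j) : IsState 2 1 (pairState i j) :=
  ⟨fun l => by rw [pairState_apply]; split_ifs <;> omega, sum_pairState i j⟩

lemma HasCard.le {α β : ℕ →₀ ℕ} {c : Card} (h : HasCard α β c) (l : ℕ) : α (l + 1) ≤ β l := by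
  cases h <;> simp only [pairState_apply, Nat.add_right_cancel_iff] <;> split_ifs <;>
    first | omega | contradiction

lemma HasCard.step {α β : ℕ →₀ ℕ} {c : Card} (h : HasCard α β c) : Step 2 2 α β := by
  refine ⟨?_, ?_, h.le⟩ <;> cases h <;> exact isState_pairState _ _

/-! ### Many hands -/

/-- The pattern `σ₁₁ → σ₁ₙ → σ₁₍ₙ₋₁₎ → ⋯ → σ₁₂ → σ₁₁`, in which every card is a throw card. -/
noncomputable def showerState (n t : ℕ) : ℕ →₀ ℕ := pairState 0 ((n - t % n) % n)

lemma showerState_periodic (n : ℕ) : Function.Periodic (showerState n) n := fun t => by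
  simp [showerState]

lemma pairState_zero_injective : Function.Injective (pairState 0) := fun _ _ h =>
  Finsupp.single_left_injective one_ne_zero (add_left_cancel h)

lemma showerState_injOn (n : ℕ) : Set.InjOn (showerState n) (Set.Iio n) := by
  intro s hs t ht h
  have hs' : s < n := hs
  have ht' : t < n := ht
  have := pairState_zero_injective h
  rw [Nat.mod_eq_of_lt hs', Nat.mod_eq_of_lt ht'] at this
  rcases Nat.eq_zero_or_pos s with rfl | hs0 <;> rcases Nat.eq_zero_or_pos t with rfl | ht0
  · rfl
  · rw [Nat.sub_zero, Nat.mod_self, Nat.mod_eq_of_lt (by omega)] at this; omega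
  · rw [Nat.sub_zero, Nat.mod_self, Nat.mod_eq_of_lt (by omega)] at this; omega
  · rw [Nat.mod_eq_of_lt (by omega), Nat.mod_eq_of_lt (by omega)] at this; omega

lemma showerState_card {n : ℕ} (hn : 2 ≤ n) (t : ℕ) :
    ∃ c, HasCard (showerState n t) (showerState n (t + 1)) c ∧ c.IsThrow := by
  have hlt : t % n < n := Nat.mod_lt _ (by omega)
  have hmod : (t + 1) % n = (t % n + 1) % n := by simp
  unfold showerState
  rw [hmod]
  generalize t % n = r at hlt
  rcases Nat.eq_zero_or_pos r with rfl | hr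
  · rw [Nat.sub_zero, Nat.mod_self, zero_add, Nat.mod_eq_of_lt (show 1 < n by omega),
      Nat.mod_eq_of_lt (show n - 1 < n by omega)]
    exact ⟨_, .db 0 (n - 1) (by omega), by simp [Card.IsThrow]⟩
  · rw [Nat.mod_eq_of_lt (show n - r < n by omega)]
    rcases Nat.lt_or_ge (r + 1) n with h1 | h1
    · rw [Nat.mod_eq_of_lt h1, Nat.mod_eq_of_lt (show n - (r + 1) < n by omega),
        show n - r = n - (r + 1) + 1 by omega]
      exact ⟨_, .c1 0 (n - (r + 1)) (by omega), by simp [Card.IsThrow]⟩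
    · rw [show r + 1 = n by omega, Nat.mod_self, Nat.sub_zero, Nat.mod_self,
        show n - r = 0 + 1 by omega]
      exact ⟨_, .da 0, by simp [Card.IsThrow]⟩

/-- Keeps only the term of the shower pattern, for which `throwCount` is n. -/
lemma pow_mul_le_passingPrimeCount {n k : ℕ} (hn : 2 ≤ n) (hk : 1 ≤ k) :
    k ^ n * (k - 1) ≤ passingPrimeCount 2 n k := by
  classical
  have hn1 : 1 ≤ n := by omega
  have hcount : throwCount (periodicCycle n (showerState n)) = n := by
    rw [throwCount_periodicCycle (showerState_periodic n), Finset.filter_true_of_mem,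
      Finset.card_range]
    exact fun t _ => showerState_card hn t
  have hmem : periodicCycle n (showerState n) ∈ strictMultiplexPrime n := by
    refine ⟨periodicCycle_mem_primeWalks (showerState_periodic n) (showerState_injOn n)
      fun t => ?_, fun h => ?_⟩
    · obtain ⟨c, hc, -⟩ := showerState_card hn t
      exact hc.step
    · have h1 := (chain_periodicCycle (showerState_periodic n)).1 h.2.2 0 (by omega)
      have := h1.1.1 0
      simp [showerState, pairState_apply] at this
  have h1 := Finset.single_le_sum (f := fun ρ => k ^ throwCount ρ * (k - 1))
    (fun _ _ => Nat.zero_le _) ((strictMultiplexPrime_finite hn1).mem_toFinset.2 hmem)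
  rw [hcount] at h1
  exact h1.trans ((Nat.le_add_left _ _).trans (sum_pow_throwCount_le hn1 hk))

theorem asympGE_passingPrimeCount_hands {n : ℕ} (hn : 2 ≤ n) :
    AsympGE (fun k => (passingPrimeCount 2 n k : ℝ)) fun k => (k : ℝ) ^ (n + 1) := by
  intro ε hε
  obtain ⟨N, hN⟩ := exists_nat_gt (1 / ε)
  filter_upwards [eventually_ge_atTop N, eventually_ge_atTop 1] with k hk hk1
  have h1 : ((k ^ n * (k - 1) : ℕ) : ℝ) ≤ passingPrimeCount 2 n k :=
    Nat.cast_le.2 (pow_mul_le_passingPrimeCount hn hk1)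
  refine le_trans ?_ h1
  push_cast [hk1]
  have h2 : 1 / ε < k := hN.trans_le (by exact_mod_cast hk)
  rw [div_lt_iff₀ hε] at h2
  have h3 : (0 : ℝ) ≤ (k : ℝ) ^ n := by positivity
  calc (1 - ε) * (k : ℝ) ^ (n + 1) = (k : ℝ) ^ n * (k - k * ε) := by ring
    _ ≤ (k : ℝ) ^ n * (k - 1) := mul_le_mul_of_nonneg_left (by linarith) h3

/-- The constant passing state with a ball landing now in each hand of `s`. -/
noncomputable def handState {k : ℕ} (s : Finset (Fin k)) (i : Fin k) : ℕ →₀ ℕ :=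
  if i ∈ s then Finsupp.single 0 1 else 0

lemma handState_apply {k : ℕ} (s : Finset (Fin k)) (i : Fin k) (j : ℕ) :
    handState s i j = if i ∈ s ∧ 0 = j then 1 else 0 := by
  by_cases h : i ∈ s <;> simp [handState, h, Finsupp.single_apply]

lemma choose_two_le_passingPrimeCount (k : ℕ) : k.choose 2 ≤ passingPrimeCount 2 1 k := by
  have hcard : ((Finset.univ : Finset (Fin k)).powersetCard 2).card = k.choose 2 := by simp
  rw [← hcard, ← Set.ncard_coe_finset]
  refine Set.ncard_le_ncard_of_injOn (fun s => periodicCycle 1 fun _ => handState s) ?_ ?_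
    (passingPrime_finite le_rfl)
  · intro s hs
    have hs2 : s.card = 2 := (Finset.mem_powersetCard.1 hs).2
    have hstate : IsPassingState 2 k (handState s) := by
      refine ⟨fun i j => by rw [handState_apply]; split_ifs <;> omega, ?_⟩
      have : ∀ i, ((handState s i).sum fun _ a => a) = if i ∈ s then 1 else 0 := fun i => by
        by_cases h : i ∈ s <;> simp [handState, h]
      simp [this, hs2]
    refine periodicCycle_mem_primeWalks (fun _ => rfl) ?_ fun _ => ⟨hstate, hstate, fun i j => ?_⟩
    · intro a ha b hb _
      have ha' : a < 1 := ha
      have hb' : b < 1 := hb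
      omega
    · simp [handState_apply]
  · intro s _ s' _ h
    have := eqOn_of_periodicCycle_eq (fun _ : Fin k → ℕ →₀ ℕ => ())
      (x := fun _ => handState s) (y := fun _ => handState s') (n := 1) (fun a ha b hb _ => by
        have ha' : a < 1 := ha
        have hb' : b < 1 := hb
        omega) (fun _ => rfl) h 0 one_pos
    ext i
    have h1 := DFunLike.congr_fun (congrFun this i) 0
    simp only [handState_apply, and_true] at h1
    by_cases h2 : i ∈ s <;> by_cases h3 : i ∈ s' <;> simp_all

theorem isBigO_passingPrimeCount_hands {n : ℕ} (hn : 1 ≤ n) :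
    (fun k : ℕ => (k : ℝ) ^ (n + 1)) =O[atTop] fun k : ℕ => (passingPrimeCount 2 n k : ℝ) := by
  -- The constant comes from n = 1, where k² ≤ 4 · k(k - 1)/2 for k ≥ 2, with equality at k = 2.
  refine Asymptotics.IsBigO.of_bound 4 ?_
  filter_upwards [eventually_ge_atTop 2] with k hk
  have hk' : (2 : ℝ) ≤ k := by exact_mod_cast hk
  rw [Real.norm_of_nonneg (by positivity), Real.norm_of_nonneg (by positivity)]
  rcases Nat.lt_or_ge n 2 with hn2 | hn2
  · obtain rfl : n = 1 := by omega
    have h1 : ((k.choose 2 : ℕ) : ℝ) ≤ passingPrimeCount 2 1 k :=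
      Nat.cast_le.2 (choose_two_le_passingPrimeCount k)
    rw [Nat.cast_choose_two] at h1
    rw [show 1 + 1 = 2 from rfl]
    nlinarith
  · have h1 : ((k ^ n * (k - 1) : ℕ) : ℝ) ≤ passingPrimeCount 2 n k :=
      Nat.cast_le.2 (pow_mul_le_passingPrimeCount hn2 (by omega))
    push_cast [show 1 ≤ k by omega] at h1
    have h3 : (0 : ℝ) ≤ (k : ℝ) ^ n := by positivity
    calc (k : ℝ) ^ (n + 1) = (k : ℝ) ^ n * k := by ring
      _ ≤ (k : ℝ) ^ n * (4 * (k - 1)) := mul_le_mul_of_nonneg_left (by linarith) h3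
      _ = 4 * ((k : ℝ) ^ n * (k - 1)) := by ring
      _ ≤ _ := by linarith

/-! ### Words describing normal patterns

A normal 2-ball pattern is determined by the cyclic sequence of distances `d` between the two balls
at the beats where a ball lands, together with a Boolean for each of them that tells whether the
throw leading to the distance `d` has card `C₂` (`true`) or `C₁` (`false`). -/

/-- A `C₁` throw decreases the distance. -/
def Desc (p q : ℕ × Bool) : Prop := q.2 = false → q.1 < p.1

/-- The states with balls landing `i + 1` and `i + d + 1` beats from now, `i = L - 1, …, 0`. -/
def run : ℕ → ℕ → List (ℕ × ℕ)
  | 0, _ => []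
  | L + 1, d => (L, d) :: run L d

/-- The number of beats between two landings, at distances `p` and `q.1`. -/
def gap (p : ℕ) (q : ℕ × Bool) : ℕ := if q.2 then p else p - q.1

/-- The sequence of states described by a word, starting after a landing at distance `p`. -/
def expand : ℕ → List (ℕ × Bool) → List (ℕ × ℕ)
  | _, [] => []
  | p, q :: w => run (gap p q) q.1 ++ expand q.1 w

/-- The state with balls landing `p.1 + 1` and `p.1 + p.2 + 1` beats from now. -/
noncomputable def gapState (p : ℕ × ℕ) : ℕ →₀ ℕ := pairState p.1 (p.1 + p.2)

/-- The length of the pattern described by a word. -/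
def wordLength (w : List (ℕ × Bool)) : ℕ := (w.map fun q => if q.2 then q.1 else 0).sum

/-- The number of `C₂` cards in the pattern described by a word. -/
def blockCount (w : List (ℕ × Bool)) : ℕ := (w.map fun q => if q.2 then 1 else 0).sum

/-- Words that describe normal prime patterns of length `n`, rotated so that the largest distance
comes last. -/
def IsWord (n : ℕ) (w : List (ℕ × Bool)) : Prop :=
  ∃ u D, w = u ++ [(D, true)] ∧ (∀ q ∈ w, 1 ≤ q.1 ∧ q.1 ≤ D) ∧ (w.map Prod.fst).Nodup ∧
    List.IsChain Desc ((D, true) :: w) ∧ wordLength w = n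

lemma gapState_injective : Function.Injective gapState := by
  rintro ⟨i, d⟩ ⟨i', d'⟩ h
  have := (Finsupp.single_add_single_eq_single_add_single one_ne_zero one_ne_zero).1 h
  simp at this
  simp only [Prod.mk.injEq]
  omega

lemma length_run (L d : ℕ) : (run L d).length = L := by
  induction L with
  | zero => rfl
  | succ L ih => rw [run, List.length_cons, ih]

lemma mem_run {L d : ℕ} {p : ℕ × ℕ} : p ∈ run L d ↔ p.1 < L ∧ p.2 = d := by
  induction L with
  | zero => simp [run]
  | succ L ih =>
    rw [run, List.mem_cons, ih, Prod.ext_iff]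
    simp only
    omega

lemma nodup_run (L d : ℕ) : (run L d).Nodup := by
  induction L with
  | zero => exact List.nodup_nil
  | succ L ih => exact List.nodup_cons.2 ⟨fun h => lt_irrefl _ (mem_run.1 h).1, ih⟩

lemma run_succ_eq_concat (L d : ℕ) : ∃ X, run (L + 1) d = X ++ [(0, d)] := by
  induction L with
  | zero => exact ⟨[], rfl⟩
  | succ L ih =>
    obtain ⟨X, hX⟩ := ih
    exact ⟨(L + 1, d) :: X, by rw [run, hX, List.cons_append]⟩

lemma countP_run {L : ℕ} (hL : 1 ≤ L) (d : ℕ) : (run L d).countP (fun p => p.1 = 0) = 1 := by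
  induction L, hL using Nat.le_induction with
  | base => rfl
  | succ L hL ih => rw [run, List.countP_cons, ih]; simp; omega

lemma one_le_gap {p : ℕ} {c : Bool} {q : ℕ × Bool} (hp : 1 ≤ p) (h : Desc (p, c) q) :
    1 ≤ gap p q := by
  rw [gap]
  split_ifs with hq
  · exact hp
  · have := h (by simpa using hq)
    simp only at this
    omega

lemma expand_eq_concat {p D : ℕ} {u : List (ℕ × Bool)} (hp : 1 ≤ p) (hu : ∀ q ∈ u, 1 ≤ q.1) :
    ∃ X, expand p (u ++ [(D, true)]) = X ++ [(0, D)] := by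
  induction u generalizing p with
  | nil =>
    obtain ⟨L, rfl⟩ := Nat.exists_eq_add_of_le' hp
    obtain ⟨X, hX⟩ := run_succ_eq_concat L D
    exact ⟨X, by simp [expand, gap, hX]⟩
  | cons q u ih =>
    obtain ⟨X, hX⟩ := ih (hu q (by simp)) fun r hr => hu r (by simp [hr])
    exact ⟨run (gap p q) q.1 ++ X, by rw [List.cons_append, expand, hX, List.append_assoc]⟩

/-- The gaps telescope: each is the preceding distance, minus the new distance for a `C₁` letter.
Hence the `C₁` distances cancel. With p = D the result is the full `wordLength`. -/
lemma length_expand {p D : ℕ} {c : Bool} {u : List (ℕ × Bool)}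
    (h : List.IsChain Desc ((p, c) :: (u ++ [(D, true)]))) :
    (expand p (u ++ [(D, true)])).length = p + wordLength u := by
  induction u generalizing p c with
  | nil => simp [expand, gap, length_run, wordLength]
  | cons q u ih =>
    rw [List.cons_append, List.isChain_cons_cons] at h
    have h2 := ih h.2
    rw [List.cons_append, expand, List.length_append, h2, length_run]
    simp only [wordLength, List.map_cons, List.sum_cons, gap]
    split_ifs with hq
    · omega
    · have := h.1 (by simpa using hq)
      simp only at this
      omega

lemma snd_mem_of_mem_expand {p : ℕ} {w : List (ℕ × Bool)} {e : ℕ × ℕ} (h : e ∈ expand p w) :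
    e.2 ∈ w.map Prod.fst := by
  induction w generalizing p with
  | nil => simp [expand] at h
  | cons q w ih =>
    rw [expand, List.mem_append] at h
    rw [List.map_cons, List.mem_cons]
    exact h.imp (fun h => (mem_run.1 h).2) ih

/-- Within a run the first coordinate decreases, and different runs have different distances. -/
lemma nodup_expand {p : ℕ} {w : List (ℕ × Bool)} (h : (w.map Prod.fst).Nodup) :
    (expand p w).Nodup := by
  induction w generalizing p with
  | nil => exact List.nodup_nil
  | cons q w ih =>
    rw [List.map_cons, List.nodup_cons] at h
    rw [expand, List.nodup_append']
    refine ⟨nodup_run _ _, ih h.2, fun e he he' => h.1 ?_⟩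
    rw [← (mem_run.1 he).2]
    exact snd_mem_of_mem_expand he'

/-- Every run is nonempty and ends in its only landing state. -/
lemma countP_expand {p : ℕ} {c : Bool} {w : List (ℕ × Bool)} (hp : 1 ≤ p)
    (hpos : ∀ q ∈ w, 1 ≤ q.1) (h : List.IsChain Desc ((p, c) :: w)) :
    (expand p w).countP (fun e => e.1 = 0) = w.length := by
  induction w generalizing p c with
  | nil => rfl
  | cons q w ih =>
    rw [List.isChain_cons_cons] at h
    rw [expand, List.countP_append, countP_run (one_le_gap hp h.1),
      ih (c := q.2) (hpos q (by simp)) (fun r hr => hpos r (by simp [hr])) h.2, List.length_cons,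
      add_comm]

lemma step_gapState {a b : ℕ × ℕ} {c : Card} (ha : 1 ≤ a.2) (hb : 1 ≤ b.2)
    (h : HasCard (gapState a) (gapState b) c) : Step 2 1 (gapState a) (gapState b) :=
  ⟨isState_pairState_of_lt (by omega), isState_pairState_of_lt (by omega), h.le⟩

lemma isChain_run {a : ℕ × ℕ} {L d : ℕ} {X : List (ℕ × ℕ)} (hd : 1 ≤ d)
    (ha : Step 2 1 (gapState a) (gapState (L, d)))
    (h : List.IsChain (fun a b => Step 2 1 (gapState a) (gapState b)) ((0, d) :: X)) :
    List.IsChain (fun a b => Step 2 1 (gapState a) (gapState b)) (a :: (run (L + 1) d ++ X)) := by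
  induction L generalizing a with
  | zero => exact List.isChain_cons_cons.2 ⟨ha, h⟩
  | succ L ih =>
    rw [run, List.cons_append, List.isChain_cons_cons]
    refine ⟨ha, ih (step_gapState (c := Card.C0) hd hd ?_)⟩
    have := HasCard.c0 L (L + d) (by omega)
    rwa [show L + d + 1 = L + 1 + d by ring] at this

lemma isChain_expand {p : ℕ} {c : Bool} {w : List (ℕ × Bool)} (hp : 1 ≤ p)
    (hpos : ∀ q ∈ w, 1 ≤ q.1) (h : List.IsChain Desc ((p, c) :: w)) :
    List.IsChain (fun a b => Step 2 1 (gapState a) (gapState b)) ((0, p) :: expand p w) := by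
  induction w generalizing p c with
  | nil => simp [expand]
  | cons q w ih =>
    rw [List.isChain_cons_cons] at h
    have hq := hpos q (by simp)
    obtain ⟨L, hL⟩ := Nat.exists_eq_add_of_le' (one_le_gap hp h.1)
    rw [expand, hL]
    refine isChain_run hq ?_ (ih (c := q.2) hq (fun r hr => hpos r (by simp [hr])) h.2)
    rw [gap] at hL
    split_ifs at hL with hb
    · refine step_gapState (c := Card.C2) hp hq ?_
      have := HasCard.c2 L (L + q.1) (by omega)
      rwa [← hL, ← zero_add p] at this
    · have hlt := h.1 (by simpa using hb)
      simp only at hlt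
      refine step_gapState (c := Card.C1) hp hq ?_
      have := HasCard.c1 L (L + q.1) (by omega)
      rwa [show L + q.1 + 1 = 0 + p by omega] at this

/-- The first state of a run shows its gap and its distance d. The gap is p for `C₂` and p - d < p
for `C₁`, so it also shows the card. -/
lemma expand_injective {p : ℕ} {c : Bool} {w w' : List (ℕ × Bool)} (hp : 1 ≤ p)
    (hpos : ∀ q ∈ w, 1 ≤ q.1) (h : List.IsChain Desc ((p, c) :: w))
    (hpos' : ∀ q ∈ w', 1 ≤ q.1) (h' : List.IsChain Desc ((p, c) :: w'))
    (heq : expand p w = expand p w') : w = w' := by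
  induction w generalizing p c w' with
  | nil =>
    rcases w' with _ | ⟨q, w'⟩
    · rfl
    · rw [List.isChain_cons_cons] at h'
      have := one_le_gap hp h'.1
      have h2 := congrArg List.length heq
      rw [expand, expand, List.length_append, length_run, List.length_nil] at h2
      omega
  | cons q w ih =>
    rw [List.isChain_cons_cons] at h
    have hg := one_le_gap hp h.1
    rcases w' with _ | ⟨q', w'⟩
    · have h2 := congrArg List.length heq
      rw [expand, expand, List.length_append, length_run, List.length_nil] at h2
      omega
    · rw [List.isChain_cons_cons] at h'
      have hg' := one_le_gap hp h'.1
      have hq := hpos q (by simp)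
      have hq' := hpos' q' (by simp)
      have hgq : gap p q = gap p q' ∧ q.1 = q'.1 := by
        obtain ⟨L, hL⟩ := Nat.exists_eq_add_of_le' hg
        obtain ⟨L', hL'⟩ := Nat.exists_eq_add_of_le' hg'
        rw [expand, expand, hL, hL', run, run, List.cons_append, List.cons_append] at heq
        have := (List.cons.inj heq).1
        rw [Prod.mk.injEq] at this
        omega
      obtain ⟨hg1, hg2⟩ := hgq
      have hqq : q = q' := by
        refine Prod.ext hg2 ?_
        rcases q with ⟨d, b⟩
        rcases q' with ⟨d', b'⟩
        simp only [gap] at hg1 hg2 hq hq' hg hg' ⊢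
        rcases b <;> rcases b' <;> simp at hg1 hg hg' ⊢ <;> omega
      subst hqq
      rw [expand, expand] at heq
      rw [ih (c := q.2) hq (fun r hr => hpos r (by simp [hr])) h.2
        (fun r hr => hpos' r (by simp [hr])) h'.2 (List.append_cancel_left heq)]

lemma eq_of_isRotated_cons {S : Type*} {a : S} {l l' : List S} (hnd : (a :: l).Nodup)
    (h : (a :: l) ~r (a :: l')) : l = l' := by
  obtain ⟨m, hm⟩ := h
  have h0 : ((a :: l).rotate m)[0]? = (a :: l)[0]? := by rw [hm]; rfl
  rw [List.getElem?_eq_getElem (by simp), List.getElem?_eq_getElem (by simp),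
    Option.some_inj, List.getElem_rotate, hnd.getElem_inj_iff] at h0
  rw [← List.rotate_mod, show m % (a :: l).length = 0 by simpa using h0, List.rotate_zero] at hm
  exact (List.cons.inj hm).2

/-- The juggling pattern described by a word. -/
noncomputable def wordCycle (w : List (ℕ × Bool)) : Cycle (ℕ →₀ ℕ) :=
  (((expand (w.getLastD (0, true)).1 w).map gapState : List (ℕ →₀ ℕ)) : Cycle (ℕ →₀ ℕ))

/-- Moving the final state (0, D) to the front fixes a canonical starting point of the cycle,
because D is the largest distance at a landing. -/
lemma IsWord.exists_wordCycle_eq {n : ℕ} {w : List (ℕ × Bool)} (hw : IsWord n w) :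
    ∃ D X, 1 ≤ D ∧ (∀ q ∈ w, 1 ≤ q.1) ∧ List.IsChain Desc ((D, true) :: w) ∧
      expand D w = X ++ [(0, D)] ∧ ((0, D) :: X).Nodup ∧ (X ++ [(0, D)]).length = n ∧
      (∀ e, (0, e) ∈ (0, D) :: X → e ≤ D) ∧
      wordCycle w = ((((0, D) :: X).map gapState : List (ℕ →₀ ℕ)) : Cycle (ℕ →₀ ℕ)) := by
  obtain ⟨u, D, rfl, hbd, hnd, hch, hlen⟩ := hw
  have hD : 1 ≤ D := (hbd (D, true) (by simp)).1
  obtain ⟨X, hX⟩ := expand_eq_concat (D := D) (u := u) hD fun q hq => (hbd q (by simp [hq])).1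
  have hperm : ((0, D) :: X).Perm (X ++ [(0, D)]) := (List.perm_append_singleton _ _).symm
  refine ⟨D, X, hD, fun q hq => (hbd q hq).1, hch, hX, ?_, ?_, fun e he => ?_, ?_⟩
  · rw [hperm.nodup_iff, ← hX]
    exact nodup_expand hnd
  · rw [← hX, length_expand hch, ← hlen]
    simp [wordLength, add_comm]
  · rw [hperm.mem_iff, ← hX] at he
    obtain ⟨q, hq, hqe⟩ := List.mem_map.1 (snd_mem_of_mem_expand he)
    have := (hbd q hq).2
    simp only at hqe
    omega
  · have hlast : ((u ++ [(D, true)]).getLastD (0, true)).1 = D := by simp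
    rw [wordCycle, hlast, hX, List.map_append, List.map_cons, List.map_cons, List.map_nil,
      Cycle.coe_cons_eq_coe_append]

lemma IsWord.wordCycle_mem {n : ℕ} {w : List (ℕ × Bool)} (hw : IsWord n w) :
    wordCycle w ∈ normalPrime 2 n := by
  obtain ⟨D, X, hD, hpos, hch, hX, hnd, hlen, -, hc⟩ := hw.exists_wordCycle_eq
  rw [hc]
  refine ⟨by simpa using hlen, Cycle.nodup_coe_iff.2 (hnd.map gapState_injective), ?_⟩
  rw [List.map_cons, Cycle.chain_coe_cons]
  have := isChain_expand hD hpos hch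
  rw [hX] at this
  have := (List.isChain_map gapState (R := Step 2 1)).2 this
  simpa using this

/-- The cycle determines D as the largest landing distance, and (0, D) occurs only once, so it
determines the expanded list. -/
lemma wordCycle_injOn (n : ℕ) : Set.InjOn wordCycle {w | IsWord n w} := by
  intro w hw w' hw' h
  obtain ⟨D, X, hD, hpos, hch, hX, hnd, -, hmax, hc⟩ := IsWord.exists_wordCycle_eq hw
  obtain ⟨D', X', hD', hpos', hch', hX', hnd', -, hmax', hc'⟩ := IsWord.exists_wordCycle_eq hw'
  rw [hc, hc'] at h
  obtain ⟨m, hm⟩ := (Quotient.exact h : List.IsRotated _ _)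
  rw [← List.map_rotate] at hm
  have hrot : ((0, D) :: X) ~r ((0, D') :: X') := ⟨m, gapState_injective.list_map hm⟩
  have hDD : D = D' := le_antisymm (hmax' D (hrot.mem_iff.1 (by simp)))
    (hmax D' (hrot.mem_iff.2 (by simp)))
  subst hDD
  have hXX := eq_of_isRotated_cons hnd hrot
  exact expand_injective hD hpos hch hpos' hch' (by rw [hX, hX', hXX])

/-! ### Landings and throw cards in normal patterns -/

lemma exists_eq_pairState {m : ℕ} {α : ℕ →₀ ℕ} (h : IsState 2 m α) {i : ℕ} (hi : 1 ≤ α i) :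
    ∃ j, α = pairState i j := by
  have h1 : Finsupp.single i 1 + (α - Finsupp.single i 1) = α :=
    add_tsub_cancel_of_le (by rwa [Finsupp.single_le_iff])
  have h2 := h.2
  rw [← h1, Finsupp.sum_add_index' (fun _ => rfl) fun _ _ _ => rfl,
    Finsupp.sum_single_index rfl] at h2
  obtain ⟨j, hj⟩ := (Finsupp.sum_eq_one_iff (α - Finsupp.single i 1)).1 (by omega)
  exact ⟨j, by rw [pairState, ← hj, h1]⟩

lemma isThrowStep_of_one {α β : ℕ →₀ ℕ} (h : Step 2 1 α β) (h0 : α 0 = 1) : IsThrowStep α β := by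
  obtain ⟨j, rfl⟩ := exists_eq_pairState h.1 h0.ge
  rcases j with _ | j
  · simp [pairState_apply] at h0
  · have h1 := h.2.2 j
    rw [pairState_apply] at h1
    obtain ⟨i, rfl⟩ := exists_eq_pairState h.2.1 (i := j) (by simpa using h1)
    have h2 := h.2.1.1 j
    rcases lt_trichotomy i j with hij | rfl | hij
    · refine ⟨Card.C1, ?_, by simp [Card.IsThrow]⟩
      rw [show pairState j i = pairState i j from add_comm _ _]
      exact .c1 i j hij
    · simp [pairState_apply] at h2
    · exact ⟨Card.C2, .c2 j i hij, by simp [Card.IsThrow]⟩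

lemma countP_le_throwCount {n : ℕ} (hn : 1 ≤ n) {ρ : Cycle (ℕ →₀ ℕ)} (hρ : ρ ∈ normalPrime 2 n) :
    Multiset.countP (fun α : ℕ →₀ ℕ => α 0 = 1) ρ.toMultiset ≤ throwCount ρ := by
  classical
  obtain ⟨α, hα, -, hstep, rfl⟩ := exists_periodic_of_mem_primeWalks hn hρ
  rw [throwCount_periodicCycle hα]
  change Multiset.countP _ ((Multiset.range n).map α) ≤ _
  rw [Multiset.countP_map]
  exact Finset.card_le_card (s := (Finset.range n).filter fun t => α t 0 = 1) fun t ht =>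
    Finset.mem_filter.2 ⟨(Finset.mem_filter.1 ht).1,
      isThrowStep_of_one (hstep t) (Finset.mem_filter.1 ht).2⟩

lemma IsWord.length_le_throwCount {n : ℕ} (hn : 1 ≤ n) {w : List (ℕ × Bool)} (hw : IsWord n w) :
    w.length ≤ throwCount (wordCycle w) := by
  refine le_trans ?_ (countP_le_throwCount hn hw.wordCycle_mem)
  obtain ⟨D, X, hD, hpos, hch, hX, hnd, hlen, hmax, hc⟩ := hw.exists_wordCycle_eq
  rw [← countP_expand hD hpos hch, hc, hX]
  change _ ≤ List.countP _ _
  rw [List.countP_map, ((List.perm_append_singleton _ _).countP_eq _)]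
  refine List.countP_mono_left fun e he h => ?_
  have he2 : 1 ≤ e.2 := by
    rw [← (List.perm_append_singleton (0, D) X).mem_iff, ← hX] at he
    obtain ⟨q, hq, hqe⟩ := List.mem_map.1 (snd_mem_of_mem_expand he)
    have := hpos q hq
    omega
  simp only [decide_eq_true_eq] at h
  simp [gapState, pairState_apply, h]
  omega

lemma isWord_finite {n : ℕ} (hn : 1 ≤ n) : {w | IsWord n w}.Finite :=
  Set.Finite.of_finite_image ((normalPrime_finite hn).subset
    (Set.image_subset_iff.2 fun _ hw => IsWord.wordCycle_mem hw)) (wordCycle_injOn n)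

lemma sum_pow_length_le {n k : ℕ} (hn : 1 ≤ n) (hk : 1 ≤ k) :
    ∑ w ∈ (isWord_finite hn).toFinset, k ^ w.length ≤ passingPrimeCount 2 n k := by
  classical
  refine le_trans ?_ ((Nat.le_add_right _ _).trans (sum_pow_throwCount_le hn hk))
  calc ∑ w ∈ (isWord_finite hn).toFinset, k ^ w.length
      ≤ ∑ w ∈ (isWord_finite hn).toFinset, k ^ throwCount (wordCycle w) :=
        Finset.sum_le_sum fun w hw => Nat.pow_le_pow_right hk
          (((isWord_finite hn).mem_toFinset.1 hw).length_le_throwCount hn)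
    _ = ∑ ρ ∈ (isWord_finite hn).toFinset.image wordCycle, k ^ throwCount ρ := by
        rw [Finset.sum_image]
        intro w hw w' hw' h
        exact wordCycle_injOn n (by simpa using hw) (by simpa using hw') h
    _ ≤ _ := Finset.sum_le_sum_of_subset fun ρ hρ => by
        obtain ⟨w, hw, rfl⟩ := Finset.mem_image.1 hρ
        exact (Set.Finite.mem_toFinset _).2
          ((isWord_finite hn).mem_toFinset.1 hw).wordCycle_mem

/-! ### Counting words -/

/-- Increase all distances by one. -/
def shiftWord (w : List (ℕ × Bool)) : List (ℕ × Bool) := w.map fun q => (q.1 + 1, q.2)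

/-- The words obtained by inserting the letter `(1, b)` in front of a `C₂` throw. -/
def inserts (b : Bool) : List (ℕ × Bool) → List (List (ℕ × Bool))
  | [] => []
  | q :: w => (if q.2 then [(1, b) :: q :: w] else []) ++ (inserts b w).map (q :: ·)

lemma shiftWord_injective : Function.Injective shiftWord :=
  List.map_injective_iff.2 fun p q h => by
    simp only [Prod.mk.injEq, Nat.add_right_cancel_iff] at h
    exact Prod.ext h.1 h.2

lemma blockCount_shiftWord (w : List (ℕ × Bool)) : blockCount (shiftWord w) = blockCount w := by
  simp [blockCount, shiftWord, Function.comp_def]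

lemma wordLength_shiftWord (w : List (ℕ × Bool)) :
    wordLength (shiftWord w) = wordLength w + blockCount w := by
  rw [wordLength, wordLength, blockCount, shiftWord, List.map_map, ← List.sum_map_add]
  congr 1
  refine List.map_congr_left fun q _ => ?_
  simp only [Function.comp]
  split_ifs <;> rfl

lemma one_lt_of_mem_shiftWord {n : ℕ} {w : List (ℕ × Bool)} (hw : IsWord n w) :
    ∀ q ∈ shiftWord w, 1 < q.1 := by
  obtain ⟨u, D, -, hbd, -⟩ := hw
  intro q hq
  obtain ⟨p, hp, rfl⟩ := List.mem_map.1 hq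
  have := (hbd p hp).1
  simp only
  omega

lemma IsWord.shiftWord {n : ℕ} {w : List (ℕ × Bool)} (hw : IsWord n w) :
    IsWord (n + blockCount w) (shiftWord w) := by
  have hlen := wordLength_shiftWord w
  obtain ⟨u, D, hu, hbd, hnd, hch, rfl⟩ := hw
  refine ⟨Juggling.shiftWord u, D + 1, by simp [hu, Juggling.shiftWord], ?_, ?_, ?_, hlen⟩
  · intro q hq
    obtain ⟨p, hp, rfl⟩ := List.mem_map.1 hq
    have := hbd p hp
    simp only
    omega
  · rw [show (Juggling.shiftWord w).map Prod.fst = (w.map Prod.fst).map (· + 1) by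
      simp [Juggling.shiftWord, Function.comp_def]]
    exact hnd.map (add_left_injective 1)
  · have h1 := (List.isChain_map (fun q : ℕ × Bool => (q.1 + 1, q.2)) (R := Desc)
      (l := (D, true) :: w)).2 (hch.imp fun p q h hq => Nat.succ_lt_succ (h hq))
    exact h1

lemma length_inserts (b : Bool) (w : List (ℕ × Bool)) : (inserts b w).length = blockCount w := by
  induction w with
  | nil => rfl
  | cons q w ih =>
    rw [inserts, List.length_append, List.length_map, ih, blockCount, blockCount, List.map_cons,
      List.sum_cons]
    split_ifs <;> rfl

lemma mem_inserts {b : Bool} {w x : List (ℕ × Bool)} (hx : x ∈ inserts b w) :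
    ∃ u d v, w = u ++ (d, true) :: v ∧ x = u ++ (1, b) :: (d, true) :: v := by
  induction w generalizing x with
  | nil => simp [inserts] at hx
  | cons q w ih =>
    rw [inserts, List.mem_append] at hx
    rcases hx with hx | hx
    · split_ifs at hx with hq
      · rw [List.mem_singleton] at hx
        exact ⟨[], q.1, w, by simp [← hq], by simp [hx, ← hq]⟩
      · simp at hx
    · obtain ⟨y, hy, rfl⟩ := List.mem_map.1 hx
      obtain ⟨u, d, v, rfl, rfl⟩ := ih hy
      exact ⟨q :: u, d, v, rfl, rfl⟩

lemma nodup_inserts {b : Bool} {w : List (ℕ × Bool)} (hw : ∀ q ∈ w, 1 < q.1) :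
    (inserts b w).Nodup := by
  induction w with
  | nil => exact List.nodup_nil
  | cons q w ih =>
    have hq := hw q (by simp)
    rw [inserts, List.nodup_append']
    refine ⟨by split_ifs <;> simp, (ih fun r hr => hw r (by simp [hr])).map
      (List.cons_injective), fun x hx hx' => ?_⟩
    split_ifs at hx
    · rw [List.mem_singleton] at hx
      obtain ⟨y, -, hy⟩ := List.mem_map.1 hx'
      rw [hx] at hy
      rw [(List.cons.inj hy).1] at hq
      exact lt_irrefl _ hq
    · simp at hx

/-- Deleting the letter of distance 1 undoes the insertion, so different words have disjoint sets of
insertions. -/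
lemma filter_of_mem_inserts {b : Bool} {w x : List (ℕ × Bool)} (hw : ∀ q ∈ w, 1 < q.1)
    (hx : x ∈ inserts b w) : x.filter (fun q => q.1 ≠ 1) = w := by
  obtain ⟨u, d, v, rfl, rfl⟩ := mem_inserts hx
  have h1 : ∀ q ∈ u ++ (d, true) :: v, decide (q.1 ≠ 1) = true := fun q hq => by
    have := hw q hq
    simp only [ne_eq, decide_eq_true_eq]
    omega
  have h2 := List.filter_eq_self.2 h1
  rw [List.filter_append] at h2
  rw [List.filter_append, List.filter_cons_of_neg (by simp), h2]

lemma mem_of_mem_inserts {b : Bool} {w x : List (ℕ × Bool)} (hx : x ∈ inserts b w) :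
    (1, b) ∈ x := by
  obtain ⟨u, d, v, rfl, rfl⟩ := mem_inserts hx
  simp

lemma length_of_mem_inserts {b : Bool} {w x : List (ℕ × Bool)} (hx : x ∈ inserts b w) :
    x.length = w.length + 1 := by
  obtain ⟨u, d, v, rfl, rfl⟩ := mem_inserts hx
  simp; omega

lemma blockCount_of_mem_inserts {b : Bool} {w x : List (ℕ × Bool)} (hx : x ∈ inserts b w) :
    blockCount x = blockCount w + if b then 1 else 0 := by
  obtain ⟨u, d, v, rfl, rfl⟩ := mem_inserts hx
  simp [blockCount]; omega

/-- Distance 1 cannot be followed by a `C₁` letter, since no positive distance is smaller; before a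
`C₂` letter there is no constraint. The preceding distance exceeds 1, so (1, b) may itself be `C₁`.
The insertion is never at the end, so D stays last. -/
lemma IsWord.of_mem_inserts {n : ℕ} {b : Bool} {w x : List (ℕ × Bool)} (hw : IsWord n w)
    (h2 : ∀ q ∈ w, 1 < q.1) (hx : x ∈ inserts b w) : IsWord (n + if b then 1 else 0) x := by
  obtain ⟨u, d, v, rfl, rfl⟩ := mem_inserts hx
  obtain ⟨u', D, hu, hbd, hnd, hch, rfl⟩ := hw
  have hperm : (u ++ (1, b) :: (d, true) :: v).Perm ((1, b) :: (u ++ (d, true) :: v)) :=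
    List.perm_middle
  have hD : 1 < D := h2 (D, true) (by simp [hu])
  refine ⟨u ++ (1, b) :: ((d, true) :: v).dropLast, D, ?_, fun q hq => ?_, ?_, ?_, ?_⟩
  · have hlast : ((d, true) :: v).getLast (by simp) = (D, true) := by
      rw [← List.getLast_append_of_ne_nil (l := u) (by simp) (by simp)]
      simp only [hu, List.getLast_concat]
    conv_lhs => rw [← List.dropLast_append_getLast (l := (d, true) :: v) (by simp), hlast]
    simp
  · rcases List.mem_cons.1 (hperm.mem_iff.1 hq) with rfl | hq
    · exact ⟨le_rfl, hD.le⟩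
    · exact hbd q hq
  · rw [(hperm.map Prod.fst).nodup_iff, List.map_cons, List.nodup_cons]
    refine ⟨fun h => ?_, hnd⟩
    obtain ⟨q, hq, hq1⟩ := List.mem_map.1 h
    have := h2 q hq
    simp only at hq1
    omega
  · rw [← List.cons_append, List.isChain_append] at hch ⊢
    refine ⟨hch.1, List.isChain_cons_cons.2 ⟨fun h => by simp at h, hch.2.1⟩, ?_⟩
    intro p hp q hq _
    obtain rfl : (1, b) = q := by simpa using hq
    rcases List.mem_cons.1 (List.mem_of_mem_getLast? hp) with rfl | hp
    · exact hD
    · exact h2 p (by simp [hp])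
  · simp [wordLength]; omega

lemma isWord_finite_all (n : ℕ) : {w | IsWord n w}.Finite := by
  rcases Nat.eq_zero_or_pos n with rfl | hn
  · convert! Set.finite_empty
    refine Set.eq_empty_of_forall_notMem fun w hw => ?_
    obtain ⟨u, D, rfl, hbd, -, -, hlen⟩ := hw
    have := (hbd (D, true) (by simp)).1
    simp [wordLength] at hlen
    omega
  · exact isWord_finite hn

/-- The words of length `n` with `t` cards `C₂`. -/
noncomputable def wordsOf (t n : ℕ) : Finset (List (ℕ × Bool)) :=
  (isWord_finite_all n).toFinset.filter fun w => blockCount w = t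

lemma mem_wordsOf {t n : ℕ} {w : List (ℕ × Bool)} :
    w ∈ wordsOf t n ↔ IsWord n w ∧ blockCount w = t := by
  simp [wordsOf]

/-- The number of words of length `n` with `t` cards `C₂`, weighted by `k` to the number of
letters. -/
noncomputable def wordWeight (k t n : ℕ) : ℕ := ∑ w ∈ wordsOf t n, k ^ w.length

lemma sum_biUnion_inserts [DecidableEq (List (ℕ × Bool))] (b : Bool) (k t n : ℕ) :
    ∑ x ∈ (wordsOf t n).biUnion fun w => (inserts b (shiftWord w)).toFinset, k ^ x.length
      = t * k * wordWeight k t n := by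
  rw [Finset.sum_biUnion, wordWeight, Finset.mul_sum]
  · refine Finset.sum_congr rfl fun w hw => ?_
    obtain ⟨hw, ht⟩ := mem_wordsOf.1 hw
    rw [Finset.sum_congr rfl fun x hx =>
      congrArg (k ^ ·) (length_of_mem_inserts (List.mem_toFinset.1 hx)), Finset.sum_const,
      List.toFinset_card_of_nodup (nodup_inserts (one_lt_of_mem_shiftWord hw)), length_inserts,
      blockCount_shiftWord, ht, smul_eq_mul, pow_succ, shiftWord, List.length_map]
    ring
  · intro w hw w' hw' hne
    rw [Function.onFun, Finset.disjoint_left]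
    intro x hx hx'
    refine hne (shiftWord_injective ?_)
    rw [← filter_of_mem_inserts (one_lt_of_mem_shiftWord (mem_wordsOf.1 hw).1)
      (List.mem_toFinset.1 hx), ← filter_of_mem_inserts
      (one_lt_of_mem_shiftWord (mem_wordsOf.1 hw').1) (List.mem_toFinset.1 hx')]

/-- Shifting a word lengthens the pattern by its number of `C₂` letters. The three terms count
shifted words, those with (1, `false`) inserted, and those with (1, `true`) inserted. The last kind
starts from only t letters `C₂`, and the new letter adds the missing length 1. The presence and type
of the letter of distance 1 separate the three kinds. -/
lemma wordWeight_rec (k t n : ℕ) :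
    (1 + (t + 1) * k) * wordWeight k (t + 1) n + t * k * wordWeight k t n
      ≤ wordWeight k (t + 1) (n + (t + 1)) := by
  classical
  set S₁ := (wordsOf (t + 1) n).image shiftWord with hS₁
  set S₂ := (wordsOf (t + 1) n).biUnion fun w => (inserts false (shiftWord w)).toFinset with hS₂
  set S₃ := (wordsOf t n).biUnion fun w => (inserts true (shiftWord w)).toFinset with hS₃
  have h1 : ∑ x ∈ S₁, k ^ x.length = wordWeight k (t + 1) n := by
    rw [hS₁, Finset.sum_image fun _ _ _ _ h => shiftWord_injective h]
    simp [wordWeight, shiftWord]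
  have h2 := sum_biUnion_inserts false k (t + 1) n
  have h3 := sum_biUnion_inserts true k t n
  have hmem₁ : ∀ x ∈ S₁, ∀ b, (1, b) ∉ x := by
    intro x hx b hb
    obtain ⟨w, hw, rfl⟩ := Finset.mem_image.1 hx
    exact lt_irrefl _ (one_lt_of_mem_shiftWord (mem_wordsOf.1 hw).1 _ hb)
  have hmem₂ : ∀ x ∈ S₂, IsWord (n + (t + 1)) x ∧ blockCount x = t + 1 ∧ (1, false) ∈ x := by
    intro x hx
    obtain ⟨w, hw, hx⟩ := Finset.mem_biUnion.1 hx
    obtain ⟨hw, ht⟩ := mem_wordsOf.1 hw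
    have hx := List.mem_toFinset.1 hx
    refine ⟨?_, ?_, mem_of_mem_inserts hx⟩
    · simpa [ht] using hw.shiftWord.of_mem_inserts (one_lt_of_mem_shiftWord hw) hx
    · rw [blockCount_of_mem_inserts hx, blockCount_shiftWord, ht]; rfl
  have hmem₃ : ∀ x ∈ S₃, IsWord (n + (t + 1)) x ∧ blockCount x = t + 1 ∧ (1, true) ∈ x := by
    intro x hx
    obtain ⟨w, hw, hx⟩ := Finset.mem_biUnion.1 hx
    obtain ⟨hw, ht⟩ := mem_wordsOf.1 hw
    have hx := List.mem_toFinset.1 hx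
    refine ⟨?_, ?_, mem_of_mem_inserts hx⟩
    · simpa [ht, add_assoc] using hw.shiftWord.of_mem_inserts (one_lt_of_mem_shiftWord hw) hx
    · rw [blockCount_of_mem_inserts hx, blockCount_shiftWord, ht]; rfl
  have hd₁₂ : Disjoint S₁ S₂ := Finset.disjoint_left.2 fun x hx hx' =>
    hmem₁ x hx _ (hmem₂ x hx').2.2
  have hd₃ : Disjoint (S₁ ∪ S₂) S₃ := by
    refine Finset.disjoint_left.2 fun x hx hx' => ?_
    obtain ⟨⟨u, D, -, -, hnd, -⟩, -, hx3⟩ := hmem₃ x hx'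
    rcases Finset.mem_union.1 hx with hx | hx
    · exact hmem₁ x hx _ hx3
    · have := List.inj_on_of_nodup_map hnd (hmem₂ x hx).2.2 hx3 rfl
      simp at this
  calc _ = ∑ x ∈ (S₁ ∪ S₂) ∪ S₃, k ^ x.length := by
        rw [Finset.sum_union hd₃, Finset.sum_union hd₁₂, h1, h2, h3]
        ring
    _ ≤ _ := by
        refine Finset.sum_le_sum_of_subset fun x hx => mem_wordsOf.2 ?_
        rcases Finset.mem_union.1 hx with hx | hx
        · rcases Finset.mem_union.1 hx with hx | hx
          · obtain ⟨w, hw, rfl⟩ := Finset.mem_image.1 hx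
            obtain ⟨hw, ht⟩ := mem_wordsOf.1 hw
            exact ⟨ht ▸ hw.shiftWord, by rw [blockCount_shiftWord, ht]⟩
          · exact ⟨(hmem₂ x hx).1, (hmem₂ x hx).2.1⟩
        · exact ⟨(hmem₃ x hx).1, (hmem₃ x hx).2.1⟩

lemma le_wordWeight_one_one (k : ℕ) : k ≤ wordWeight k 1 1 := by
  have hmem : [(1, true)] ∈ wordsOf 1 1 :=
    mem_wordsOf.2 ⟨⟨[], 1, rfl, by simp, by simp, by simp [Desc], rfl⟩, rfl⟩
  have := Finset.single_le_sum (f := fun w : List (ℕ × Bool) => k ^ w.length)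
    (fun _ _ => Nat.zero_le _) hmem
  unfold wordWeight
  simpa using this

lemma sum_wordWeight_le {n k : ℕ} (hn : 1 ≤ n) (hk : 1 ≤ k) (T : Finset ℕ) :
    ∑ t ∈ T, wordWeight k t n ≤ passingPrimeCount 2 n k := by
  classical
  refine le_trans ?_ (sum_pow_length_le hn hk)
  unfold wordWeight
  rw [← Finset.sum_biUnion]
  · refine Finset.sum_le_sum_of_subset (Finset.biUnion_subset.2 fun t _ => ?_)
    exact Finset.filter_subset _ _
  · intro t _ t' _ hne
    rw [Function.onFun, Finset.disjoint_left]
    exact fun w hw hw' => hne ((mem_wordsOf.1 hw).2.symm.trans (mem_wordsOf.1 hw').2)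

/-! ### Asymptotics for a fixed number of hands -/

lemma add_three_lt_two_pow (t : ℕ) : ((t + 2 : ℕ) : ℝ) + 1 < 2 ^ (t + 2) := by
  have : t + 2 + 1 < 2 ^ (t + 2) := by
    induction t with
    | zero => norm_num
    | succ t ih => rw [show t + 1 + 2 = t + 2 + 1 by ring, pow_succ]; omega
  exact_mod_cast this

lemma q_succ_succ (t : ℕ) :
    q (t + 2) = ((t : ℝ) + 1) / (2 ^ (t + 2) - (t + 2) - 1) * q (t + 1) := by
  rw [q]
  push_cast
  ring_nf

lemma q_pos (t : ℕ) : 0 < q (t + 1) := by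
  induction t with
  | zero => norm_num [q]
  | succ t ih =>
    have := add_three_lt_two_pow t
    push_cast at this
    rw [q_succ_succ]
    exact mul_pos (div_pos (by positivity) (by linarith)) ih

lemma summable_gammaTerm {k : ℕ} (hk : 1 ≤ k) :
    Summable fun t : ℕ => gammaTerm k (t + 1) := by
  have hk' : (1 : ℝ) ≤ k := by exact_mod_cast hk
  have hpos : ∀ t : ℕ, 0 ≤ gammaTerm k (t + 1) := fun t => by
    refine mul_nonneg (mul_nonneg (q_pos t).le (by positivity)) ?_
    have : (0 : ℝ) ≤ (k - 1) * ((t + 1 : ℕ) : ℝ) := mul_nonneg (by linarith) (by positivity)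
    linarith
  refine summable_of_ratio_norm_eventually_le (r := 1 / 2) (by norm_num) ?_
  have h1 := tendsto_pow_const_div_const_pow_of_one_lt 1 (r := (2 : ℝ)) one_lt_two
  -- The bound 1 / (8k + 2) is chosen so that the denominator D below is at least 4k(t + 1). The
  -- factor k(t + 1)/D is then at most 1/4, and the linear factor at most doubles.
  have h2 := h1.eventually (gt_mem_nhds (show (0 : ℝ) < 1 / (8 * k + 2) by positivity))
  filter_upwards [(tendsto_add_atTop_nat 2).eventually h2] with t ht
  rw [Real.norm_of_nonneg (hpos _), Real.norm_of_nonneg (hpos _)]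
  rw [div_lt_div_iff₀ (by positivity) (by positivity)] at ht
  push_cast at ht
  have hD := add_three_lt_two_pow t
  push_cast at hD
  set D : ℝ := 2 ^ (t + 2) - (t + 2) - 1 with hDdef
  have hD0 : 0 < D := by linarith
  have ht0 : (0 : ℝ) ≤ t := by positivity
  have hkt : (0 : ℝ) ≤ k * t := by positivity
  have h3 : 4 * k * ((t : ℝ) + 1) ≤ D := by nlinarith
  have hq := (q_pos t).le
  have h4 : (0 : ℝ) ≤ (k - 1) * t := mul_nonneg (by linarith) ht0
  calc gammaTerm k (t + 1 + 1)
      = q (t + 1) * (k : ℝ) ^ (t + 1) * (k * ((t + 1) / D) * (1 + (k - 1) * (t + 2))) := by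
        rw [gammaTerm, show t + 1 + 1 = t + 2 from rfl, q_succ_succ, ← hDdef]
        push_cast
        ring
    _ ≤ q (t + 1) * (k : ℝ) ^ (t + 1) * (1 / 4 * (2 * (1 + (k - 1) * (t + 1)))) := by
        refine mul_le_mul_of_nonneg_left (mul_le_mul ?_ ?_ ?_ (by norm_num)) (by positivity)
        · rw [← mul_div_assoc, div_le_iff₀ hD0]
          linarith
        · nlinarith
        · nlinarith
    _ = 1 / 2 * gammaTerm k (t + 1) := by
        rw [gammaTerm]
        push_cast
        ring

/-- A contractive recursion preserves asymptotic lower bounds. -/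
lemma eventually_le_of_contraction {u v : ℕ → ℝ} {r ℓ : ℝ} {s : ℕ} (hu : ∀ n, 0 ≤ u n)
    (hr0 : 0 ≤ r) (hr1 : r < 1) (hrec : ∀ n, r * u n + v n ≤ u (n + s))
    (hv : ∀ c < ℓ, ∀ᶠ n in atTop, c ≤ v n) {c : ℝ} (hc : c < ℓ / (1 - r)) :
    ∀ᶠ n in atTop, c ≤ u n := by
  obtain ⟨c₁, hc₁, hc₁'⟩ := exists_between hc
  have h1r : 0 < 1 - r := by linarith
  obtain ⟨N, hN⟩ := eventually_atTop.1 (hv (c₁ * (1 - r)) ((lt_div_iff₀ h1r).1 hc₁'))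
  -- c₁ is the fixed point of x ↦ r x + c₁(1 - r), approached from 0 at rate r. The bound is uniform
  -- in the start n ≥ N, so one j serves all residues modulo s.
  have hj : ∀ j n, N ≤ n → c₁ - r ^ j * c₁ ≤ u (n + j * s) := by
    intro j n hn
    induction j with
    | zero => simpa using hu n
    | succ j ih =>
      have h1 := hrec (n + j * s)
      have h2 := hN (n + j * s) (by omega)
      have h3 := mul_le_mul_of_nonneg_left ih hr0
      rw [show n + (j + 1) * s = n + j * s + s by ring, pow_succ]
      linarith
  have hlim : Tendsto (fun j : ℕ => c₁ - r ^ j * c₁) atTop (nhds (c₁ - 0 * c₁)) :=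
    ((tendsto_pow_atTop_nhds_zero_of_lt_one hr0 hr1).mul_const c₁).const_sub c₁
  obtain ⟨j, hj'⟩ := (hlim.eventually (lt_mem_nhds (by simpa using hc₁))).exists
  filter_upwards [eventually_ge_atTop (N + j * s)] with n hn
  have := hj j (n - j * s) (by omega)
  rw [Nat.sub_add_cancel (by omega)] at this
  exact hj'.le.trans this

lemma le_wordWeight_one (k n : ℕ) : k * (1 + k) ^ n ≤ wordWeight k 1 (n + 1) := by
  induction n with
  | zero => simpa using le_wordWeight_one_one k
  | succ n ih =>
    have := wordWeight_rec k 0 (n + 1)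
    simp only [zero_add, one_mul, zero_mul, add_zero] at this
    calc k * (1 + k) ^ (n + 1) = (1 + k) * (k * (1 + k) ^ n) := by ring
      _ ≤ _ := (Nat.mul_le_mul_left _ ih).trans this

/-- There are asymptotically at least `q_t 2 ^ n` words with `t` cards `C₂`. -/
lemma eventually_le_wordWeight (t : ℕ) : ∀ c < q (t + 1), ∀ᶠ n : ℕ in atTop,
    c ≤ (wordWeight 1 (t + 1) n : ℝ) / 2 ^ n := by
  induction t with
  | zero =>
    intro c hc
    filter_upwards [eventually_ge_atTop 1] with n hn
    obtain ⟨m, rfl⟩ := Nat.exists_eq_add_of_le' hn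
    have h1 : ((1 * (1 + 1) ^ m : ℕ) : ℝ) ≤ wordWeight 1 1 (m + 1) :=
      Nat.cast_le.2 (le_wordWeight_one 1 m)
    push_cast at h1
    rw [le_div_iff₀ (by positivity), pow_succ]
    simp only [zero_add, q] at hc ⊢
    have h2 : (0 : ℝ) < 2 ^ m := by positivity
    norm_num at h1
    nlinarith
  | succ t ih =>
    intro c hc
    have hlt := add_three_lt_two_pow t
    push_cast at hlt
    have h2 : (0 : ℝ) < 2 ^ (t + 2) := by positivity
    refine eventually_le_of_contraction (r := ((t : ℝ) + 3) / 2 ^ (t + 2))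
      (v := fun n => ((t : ℝ) + 1) / 2 ^ (t + 2) * ((wordWeight 1 (t + 1) n : ℝ) / 2 ^ n))
      (ℓ := ((t : ℝ) + 1) / 2 ^ (t + 2) * q (t + 1)) (s := t + 2) (fun n => by positivity)
      (by positivity) (by rw [div_lt_one h2]; linarith) (fun n => ?_) (fun c' hc' => ?_) ?_
    · have h := wordWeight_rec 1 (t + 1) n
      have h' : (((1 + (t + 1 + 1) * 1) * wordWeight 1 (t + 1 + 1) n
          + (t + 1) * 1 * wordWeight 1 (t + 1) n : ℕ) : ℝ)
          ≤ wordWeight 1 (t + 1 + 1) (n + (t + 1 + 1)) := Nat.cast_le.2 h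
      push_cast at h'
      rw [le_div_iff₀ (by positivity), pow_add]
      refine le_trans (le_of_eq ?_) h'
      field_simp
      ring
    · have ha : (0 : ℝ) < ((t : ℝ) + 1) / 2 ^ (t + 2) := by positivity
      filter_upwards [ih (c' / (((t : ℝ) + 1) / 2 ^ (t + 2)))
        ((div_lt_iff₀' ha).2 hc')] with n hn
      exact (div_le_iff₀' ha).1 hn
    · refine lt_of_lt_of_eq hc ?_
      rw [show t + 1 + 1 = t + 2 from rfl, q_succ_succ]
      have hD : (2 : ℝ) ^ (t + 2) - (t + 2) - 1 ≠ 0 := by linarith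
      have hD' : (1 : ℝ) - (t + 3) / 2 ^ (t + 2) = (2 ^ (t + 2) - (t + 2) - 1) / 2 ^ (t + 2) := by
        field_simp
        ring
      rw [hD']
      field_simp

theorem asympGE_passingPrimeCount_length {k : ℕ} (hk : 1 ≤ k) :
    AsympGE (fun n => (passingPrimeCount 2 n k : ℝ))
      fun n => (∑' t : ℕ, gammaTerm k (t + 1)) * 2 ^ n := by
  intro ε hε
  have hsum := summable_gammaTerm hk
  set γ := ∑' t : ℕ, gammaTerm k (t + 1) with hγ
  rcases hk.eq_or_lt with rfl | hk2
  · have hterm : ∀ t : ℕ, gammaTerm 1 (t + 1) = q (t + 1) := fun t => by simp [gammaTerm]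
    have hγpos : 0 < γ := hsum.tsum_pos (fun t => by rw [hterm]; exact (q_pos t).le) 0
      (by rw [hterm]; exact q_pos 0)
    obtain ⟨T, hT⟩ := (hsum.hasSum.tendsto_sum_nat.eventually
      (lt_mem_nhds (show (1 - ε) * γ < γ by nlinarith))).exists
    simp only [hterm] at hT
    set δ := (∑ t ∈ Finset.range T, q (t + 1) - (1 - ε) * γ) / (T + 1) with hδ
    -- The surplus of the partial sum over (1 - ε)γ is split so that T losses of δ do not exhaust
    -- it; T + 1 avoids division by zero.
    have hT1 : (0 : ℝ) < (T : ℝ) + 1 := by positivity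
    have hδ0 : 0 < δ := div_pos (by linarith) hT1
    have hev : ∀ᶠ n : ℕ in atTop, ∀ t ∈ Finset.range T,
        q (t + 1) - δ ≤ (wordWeight 1 (t + 1) n : ℝ) / 2 ^ n :=
      (Finset.eventually_all _).2 fun t _ => eventually_le_wordWeight t _ (by linarith)
    filter_upwards [hev, eventually_ge_atTop 1] with n hn hn1
    have h2 : (0 : ℝ) < 2 ^ n := by positivity
    have h1 := sum_wordWeight_le hn1 le_rfl ((Finset.range T).map (addRightEmbedding 1)) (k := 1)
    rw [Finset.sum_map] at h1
    have h1' : ((∑ t ∈ Finset.range T, wordWeight 1 (t + 1) n : ℕ) : ℝ)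
        ≤ passingPrimeCount 2 n 1 := Nat.cast_le.2 h1
    push_cast at h1'
    have h3 := Finset.sum_le_sum hn
    rw [← Finset.sum_div, Finset.sum_sub_distrib, Finset.sum_const, Finset.card_range,
      nsmul_eq_mul, le_div_iff₀ h2] at h3
    have h4 : (T + 1) * δ = ∑ t ∈ Finset.range T, q (t + 1) - (1 - ε) * γ := by
      rw [hδ]; field_simp
    rw [← mul_assoc]
    refine le_trans (mul_le_mul_of_nonneg_right ?_ h2.le) (h3.trans h1')
    linarith
  -- For k ≥ 2 the words with one `C₂` letter give at least 3^(n - 1), which eventually exceeds any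
  -- multiple of 2^n; the factor 3 below absorbs the shift n = m + 1.
  · have hlim := tendsto_pow_atTop_atTop_of_one_lt (show (1 : ℝ) < 3 / 2 by norm_num)
    filter_upwards [hlim.eventually_ge_atTop (3 * ((1 - ε) * γ)), eventually_ge_atTop 1]
      with n hn hn1
    obtain ⟨m, rfl⟩ := Nat.exists_eq_add_of_le' hn1
    have h1 := sum_wordWeight_le hn1 hk {1}
    rw [Finset.sum_singleton] at h1
    have h2 : 3 ^ m ≤ passingPrimeCount 2 (m + 1) k :=
      calc 3 ^ m ≤ (1 + k) ^ m := Nat.pow_le_pow_left (by omega) m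
        _ ≤ k * (1 + k) ^ m := Nat.le_mul_of_pos_left _ (by omega)
        _ ≤ _ := (le_wordWeight_one k m).trans h1
    have h2' : ((3 ^ m : ℕ) : ℝ) ≤ passingPrimeCount 2 (m + 1) k := Nat.cast_le.2 h2
    push_cast at h2'
    have h3 : (0 : ℝ) < 2 ^ (m + 1) := by positivity
    rw [div_pow, le_div_iff₀ h3, pow_succ (3 : ℝ)] at hn
    linarith

end Juggling

theorem mainTheorem9 :
    -- the lower bound for every length `n` and every number of hands `k`
    (∀ n k : ℕ, 1 ≤ n → 1 ≤ k →
      (Juggling.normalPrime 2 n).Finite ∧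
      (Juggling.strictMultiplexPrime n).Finite ∧
      (Juggling.passingPrime 2 n k).Finite ∧
      (∑ᶠ ρ ∈ Juggling.normalPrime 2 n, (k : ℤ) ^ Juggling.throwCount ρ) +
          (∑ᶠ ρ ∈ Juggling.strictMultiplexPrime n,
            (k : ℤ) ^ Juggling.throwCount ρ * ((k : ℤ) - 1))
        ≤ (Juggling.passingPrimeCount 2 n k : ℤ)) ∧
    -- fixed `n`, `k → ∞`
    (∀ n : ℕ, 2 ≤ n →
      Juggling.AsympGE (fun k => (Juggling.passingPrimeCount 2 n k : ℝ))
        (fun k => (k : ℝ) ^ (n + 1))) ∧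
    (∀ n : ℕ, 1 ≤ n →
      (fun k : ℕ => (k : ℝ) ^ (n + 1)) =O[Filter.atTop]
        (fun k : ℕ => (Juggling.passingPrimeCount 2 n k : ℝ))) ∧
    -- fixed `k`, `n → ∞`
    (∀ k : ℕ, 1 ≤ k →
      Summable (fun t : ℕ => Juggling.gammaTerm k (t + 1)) ∧
      Juggling.AsympGE (fun n => (Juggling.passingPrimeCount 2 n k : ℝ))
        (fun n => (∑' t : ℕ, Juggling.gammaTerm k (t + 1)) * 2 ^ n)) := by
  exact ⟨fun n k hn hk => ⟨Juggling.normalPrime_finite hn, Juggling.strictMultiplexPrime_finite hn,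
      Juggling.passingPrime_finite hn, Juggling.finsum_pow_throwCount_le hn hk⟩,
    fun n hn => Juggling.asympGE_passingPrimeCount_hands hn,
    fun n hn => Juggling.isBigO_passingPrimeCount_hands hn,
    fun k hk => ⟨Juggling.summable_gammaTerm hk, Juggling.asympGE_passingPrimeCount_length hk⟩⟩
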